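/- Let $d\ge 1$ and $\theta\ge 0$ be real numbers. The $d$-PWIT is the random rooted tree in which every vertex has countably many children $v_1,v_2,\dots$, where, independently for each vertex $v$, the $d$-th powers of the lengths $l_1, l_2,\dots$ of the edges from $v$ to its children are the points of a rate $1$ Poisson process on the positive reals. Its $\theta$-cluster consists of the vertices that can be reached from the root by downward paths of edges of length at most $\theta$. A \emph{valuation} is a real function $f$ on the vertices of the $\theta$-cluster such that, for every vertex $v$ of the cluster, $$f(v)=\min\bigl(\theta/2,\; l_i-f(v_i)\bigr),$$ the minimum being over $\theta/2$ and all $l_i-f(v_i)$, where $v_i$ ranges over the children of $v$ in the cluster and $l_i$ is the length of the edge from $v$ to $v_i$. For $k\ge 0$ let $f_B^k$ (respectively $f_A^k$) be the function on the vertices of the cluster at distance at most $k$ from the root that is equal to $(-1)^k\theta/2$ (respectively $-(-1)^k\theta/2$) at distance exactly $k$ and satisfies the above recursion at distance less than $k$. Then: (1) Almost surely there is exactly one valuation on the $\theta$-cluster. Moreover, almost surely the limits $f_A(v)=\lim_{k\to\infty} f_A^k(v)$ and $f_B(v)=\lim_{k\to\infty} f_B^k(v)$ exist at every vertex $v$ of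 the cluster, $f_A$ and $f_B$ are valuations, and $f_A=f_B$. (2) The operator $V_\theta$ on integrable real functions on $[-\theta/2,\theta/2]$, given by $$(V_\theta F)(x)=\exp\Bigl(-d\int_0^{\theta/2+x} l^{d-1}F(l-x)\,dl\Bigr),\qquad -\theta/2\le x\le\theta/2,$$ has exactly one fixed point. (3) There is $\delta_0>0$, depending only on $d$ and $\theta$, such that for every $0<\delta\le\delta_0$ the following random set $R$ of vertices has finite expected cardinality: $R$ is the set of vertices of the $\theta$-cluster that are reached from the root by downward paths in the cluster all of whose moves $v\to v_i$ satisfy $l_i-f_B(v_i)\le f_B(v)+\delta$ if $v$ is at even distance from the root, and $l_i-f_B(v_i)=f_B(v)$ if $v$ is at odd distance from the root. -/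

import Mathlib

open MeasureTheory ProbabilityTheory Filter Topology Set

universe u

namespace GraphExploration

/-! Vertices of the infinite tree are finite sequences of natural numbers, most recent step first:
the root is `[]` and the `i`-th child of `v` is `i :: v`.  A weighting is a function `ℓ`, where
`ℓ v i` is the length of the edge from `v` to its `i`-th child.  The vertex `v` is at distance
`v.length` from the root. -/

/-- `ℓ` is (a realization on the probability space `(Ω, P)` of) the `d`-PWIT: independently for
each vertex, the `d`-th powers of the lengths of the edges to its children are the points
`E₀, E₀ + E₁, E₀ + E₁ + E₂, …` of a rate one Poisson process on the positive reals, where the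
`Eⱼ` are independent exponential variables of mean one. -/
def IsPWIT (d : ℝ) {Ω : Type u} [MeasurableSpace Ω] (P : Measure Ω)
    (ℓ : Ω → List ℕ → ℕ → ℝ) : Prop :=
  ∃ E : List ℕ × ℕ → Ω → ℝ,
    (∀ e, Measurable (E e)) ∧ (∀ e, P.map (E e) = expMeasure 1) ∧ iIndepFun E P ∧
      ∀ ω v i, ℓ ω v i = (∑ j ∈ Finset.range (i + 1), E (v, j) ω) ^ (1 / d)

/-- The `θ`-cluster of the root: the vertices reached from the root by downward paths of edges of
length at most `θ`. -/
def cluster (ℓ : List ℕ → ℕ → ℝ) (θ : ℝ) : List ℕ → Prop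
  | [] => True
  | i :: v => cluster ℓ θ v ∧ ℓ v i ≤ θ

/-- A valuation is a function on the vertices of the `θ`-cluster such that `f v` is the minimum of
`θ / 2` and the numbers `ℓ v i - f (i :: v)`, over the children `i :: v` of `v` in the cluster. -/
def IsValuation (ℓ : List ℕ → ℕ → ℝ) (θ : ℝ) (f : {v : List ℕ // cluster ℓ θ v} → ℝ) : Prop :=
  ∀ v : {v : List ℕ // cluster ℓ θ v},
    IsLeast (insert (θ / 2)
      {x : ℝ | ∃ (i : ℕ) (h : cluster ℓ θ (i :: v.1)), x = ℓ v.1 i - f ⟨i :: v.1, h⟩}) (f v)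

/-- The value obtained at `v` when all vertices `n` levels below `v` are given the value `c` and
values are propagated upwards by the recursion for valuations. -/
noncomputable def propagate (ℓ : List ℕ → ℕ → ℝ) (θ c : ℝ) : ℕ → List ℕ → ℝ
  | 0, _ => c
  | n + 1, v =>
      sInf (insert (θ / 2)
        {x : ℝ | ∃ i : ℕ, ℓ v i ≤ θ ∧ x = ℓ v i - propagate ℓ θ c n (i :: v)})

/-- The partial valuation in favor of Bob: vertices at distance `k` from the root get the value
`θ / 2` if `k` is even and `-θ / 2` if `k` is odd.  It is meaningful at distance at most `k`. -/
noncomputable def partialB (ℓ : List ℕ → ℕ → ℝ) (θ : ℝ) (k : ℕ) (v : List ℕ) : ℝ :=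
  propagate ℓ θ (if Even k then θ / 2 else -(θ / 2)) (k - v.length) v

/-- The partial valuation in favor of Alice: vertices at distance `k` from the root get the value
`-θ / 2` if `k` is even and `θ / 2` if `k` is odd.  It is meaningful at distance at most `k`. -/
noncomputable def partialA (ℓ : List ℕ → ℕ → ℝ) (θ : ℝ) (k : ℕ) (v : List ℕ) : ℝ :=
  propagate ℓ θ (if Even k then -(θ / 2) else θ / 2) (k - v.length) v

/-- `f_B`, the pointwise limit of the partial valuations in favor of Bob. -/
noncomputable def valueB (ℓ : List ℕ → ℕ → ℝ) (θ : ℝ) (v : List ℕ) : ℝ :=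
  limUnder atTop fun k : ℕ => partialB ℓ θ k v

/-- `f_A`, the pointwise limit of the partial valuations in favor of Alice. -/
noncomputable def valueA (ℓ : List ℕ → ℕ → ℝ) (θ : ℝ) (v : List ℕ) : ℝ :=
  limUnder atTop fun k : ℕ => partialA ℓ θ k v

/-- The tree of near-optimal play: the vertices of the `θ`-cluster reached from the root by
`δ`-reasonable moves of Alice (who moves at even distance from the root) and optimal moves of Bob
(who moves at odd distance), both judged by `f_B`. -/
def nearOptimal (ℓ : List ℕ → ℕ → ℝ) (θ δ : ℝ) : List ℕ → Prop
  | [] => True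
  | i :: v => nearOptimal ℓ θ δ v ∧ ℓ v i ≤ θ ∧
      (Even v.length → ℓ v i - valueB ℓ θ (i :: v) ≤ valueB ℓ θ v + δ) ∧
      (¬ Even v.length → ℓ v i - valueB ℓ θ (i :: v) = valueB ℓ θ v)

/-- The operator `V_θ` on functions on `[-θ/2, θ/2]`.  For `x` in this interval, only the values
of `F` on this interval matter. -/
noncomputable def opV (d θ : ℝ) (F : ℝ → ℝ) (x : ℝ) : ℝ :=
  Real.exp (-(d * ∫ l in (0 : ℝ)..(θ / 2 + x), l ^ (d - 1) * F (l - x)))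

/-- `F` is, on `[-θ/2, θ/2]`, an integrable function with `V_θ F = F`. -/
def IsFixedPointV (d θ : ℝ) (F : ℝ → ℝ) : Prop :=
  IntegrableOn F (Icc (-(θ / 2)) (θ / 2)) ∧ EqOn (opV d θ F) F (Icc (-(θ / 2)) (θ / 2))

end GraphExploration

/-! At every vertex the children, with the `d`-th powers of the edge lengths as positions and their
subtrees as marks, form a rate one Poisson process whose marks are independent copies of the whole
tree (`map_rootPoints_treeLaw`). So the root can be studied with the Mecke formula `mecke` and the
void probabilities `pointLaw_void`. The recursion is a single order-reversing operator, `bellman`.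
Started `n` levels down from the extreme values `-θ/2` and `θ/2`, it yields `lower` and `upper`,
which enclose every valuation and every partial valuation and converge monotonically to limits `L ≤
U` with `U = bellman L` and `L = bellman U`. Part (1) thus reduces to `L = U` almost surely.

For this (`ae_lowerLim_eq_upperLim`), ties between offers have probability zero, so `P(U < θ/2)` is
the expected number of children with an optimal offer. By Mecke this is `E (L + U')₊^d` with `L` and
`U'` independent. In the same way `P(L < θ/2) = E (U + L')₊^d`, and the two expressions coincide by
symmetry. The void probabilities give `P(U ≥ θ/2) = exp(-E (θ/2 + L)^d)` and `P(L ≥ θ/2) = exp(-E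
(θ/2 + U)^d)`. Hence the two moments agree, and `L ≤ U` forces equality.

For (2), `V_θ` sends the tail function of the values of the children to that of the root, so the
tail of the common limit is a fixed point. An arbitrary fixed point takes values in `(0, 1]`, hence
lies between the tails of the two extreme starts; since `V_θ` reverses order, it stays between the
tails of `lower` and `upper` at every level. In the limit it is at most the tail of `U`, and one
more application of `V_θ` gives the reverse inequality.

For (3), the number of continuations of a path is bounded conditionally on the value at its starting
vertex (`Dominated`). Bob has an optimal move only where the value is below `θ/2`. Given its offer
`z`, the child chosen by an optimal move of Alice has a value `h` with law biased by the density `d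
(z + h)₊^(d-1)`. This density is nondecreasing in `h`, so the bias does not make `h < θ/2` likelier
than `P(f_B < θ/2)`, which is less than `1`. Suboptimal moves add at most `δ` times the density at
`θ`. For small `δ` each pair of moves costs a factor less than `1`, and the expected numbers of
paths are bounded by a geometric series. -/

namespace GraphExploration

/-! ### Splitting infinite product measures -/

/-- The sequence with first term `a` and tail `c`. -/
def consSeq {X : Type*} (a : X) (c : ℕ → X) : ℕ → X
  | 0 => a
  | n + 1 => c n

@[simp] lemma consSeq_zero {X : Type*} (a : X) (c : ℕ → X) : consSeq a c 0 = a := rfl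

@[simp] lemma consSeq_succ {X : Type*} (a : X) (c : ℕ → X) (n : ℕ) :
    consSeq a c (n + 1) = c n := rfl

lemma measurable_consSeq {X : Type*} [MeasurableSpace X] :
    Measurable fun p : X × (ℕ → X) => consSeq p.1 p.2 := by
  refine measurable_pi_lambda _ fun n => ?_
  cases n with
  | zero => exact measurable_fst
  | succ n => exact (measurable_pi_apply n).comp measurable_snd

@[fun_prop] lemma measurable_consSeq_of {X Y : Type*} [MeasurableSpace X] [MeasurableSpace Y]
    {f : Y → X} {g : Y → ℕ → X} (hf : Measurable f) (hg : Measurable g) :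
    Measurable fun y => consSeq (f y) (g y) :=
  measurable_consSeq.comp (hf.prodMk hg)

/-- An infinite product indexed by `Option κ` splits off the factor of `none`. -/
lemma map_option_infinitePi {κ X : Type*} [MeasurableSpace X] (μ : Measure X)
    [IsProbabilityMeasure μ] :
    (Measure.infinitePi fun _ : Option κ => μ).map (fun f => (f none, fun k => f (some k))) =
      μ.prod (Measure.infinitePi fun _ : κ => μ) := by
  classical
  have key : (μ.prod (Measure.infinitePi fun _ : κ => μ)).map
      (fun p (o : Option κ) => o.elim p.1 p.2) = Measure.infinitePi fun _ : Option κ => μ := by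
    have hm : Measurable fun (p : X × (κ → X)) (o : Option κ) => o.elim p.1 p.2 := by
      refine measurable_pi_lambda _ fun o => ?_
      cases o with
      | none => exact measurable_fst
      | some k => exact (measurable_pi_apply k).comp measurable_snd
    refine Measure.eq_infinitePi _ fun s t ht => ?_
    rw [Measure.map_apply hm (.pi s.countable_toSet fun _ _ => ht _)]
    have : (fun (p : X × (κ → X)) (o : Option κ) => o.elim p.1 p.2) ⁻¹' (Set.pi s t) =
        (if none ∈ s then t none else univ) ×ˢ
          (Set.pi (Finset.eraseNone s) fun k => t (some k)) := by
      ext p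
      simp only [mem_preimage, Set.mem_pi, Finset.mem_coe, mem_prod, Finset.mem_eraseNone]
      constructor
      · intro h
        refine ⟨?_, fun k hk => h _ hk⟩
        split_ifs with hn
        · exact h _ hn
        · trivial
      · rintro ⟨h1, h2⟩ o ho
        cases o with
        | none => simpa [ho] using h1
        | some k => exact h2 k ho
    rw [this, Measure.prod_prod, Measure.infinitePi_pi _ fun _ _ => ht _]
    by_cases hn : none ∈ s
    · have hs : s = insert none ((Finset.eraseNone s).map Function.Embedding.some) := by
        rw [Finset.map_some_eraseNone, Finset.insert_erase hn]
      conv_rhs => rw [hs]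
      rw [Finset.prod_insert (by simp), Finset.prod_map, if_pos hn]
      rfl
    · have hs : s = (Finset.eraseNone s).map Function.Embedding.some := by
        rw [Finset.map_some_eraseNone, Finset.erase_eq_of_notMem hn]
      conv_rhs => rw [hs]
      rw [Finset.prod_map, if_neg hn, measure_univ, one_mul]
      rfl
  have hm' : Measurable fun f : Option κ → X => (f none, fun k => f (some k)) := by fun_prop
  have hm : Measurable fun (p : X × (κ → X)) (o : Option κ) => o.elim p.1 p.2 := by
    refine measurable_pi_lambda _ fun o => ?_
    cases o with
    | none => exact measurable_fst
    | some k => exact (measurable_pi_apply k).comp measurable_snd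
  rw [← key, Measure.map_map hm' hm]
  exact Measure.map_id

/-- Reindexing an infinite product of copies of one measure. -/
lemma map_comp_equiv_infinitePi {ι κ X : Type*} [MeasurableSpace X] (μ : Measure X)
    [IsProbabilityMeasure μ] (e : κ ≃ ι) :
    (Measure.infinitePi fun _ : ι => μ).map (fun f k => f (e k)) =
      Measure.infinitePi fun _ : κ => μ := by
  have := Measure.infinitePi_map_piCongrLeft (fun _ : κ => μ) e.symm
  rw [← this]
  congr 1
  ext f k
  simpa [MeasurableEquiv.coe_piCongrLeft] using (Equiv.piCongrLeft_apply_apply (fun _ : κ => X) e.symm f (e k)).symm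

lemma map_consSeq {X : Type*} [MeasurableSpace X] (μ : Measure X) [IsProbabilityMeasure μ] :
    (μ.prod (Measure.infinitePi fun _ : ℕ => μ)).map (fun p => consSeq p.1 p.2) =
      Measure.infinitePi fun _ : ℕ => μ := by
  let e : ℕ ≃ Option ℕ :=
    { toFun := fun n => Nat.casesOn n none some
      invFun := fun o => o.elim 0 Nat.succ
      left_inv := by rintro (_ | n) <;> rfl
      right_inv := by rintro (_ | n) <;> rfl }
  rw [← map_option_infinitePi, Measure.map_map measurable_consSeq (by fun_prop),
    ← map_comp_equiv_infinitePi μ e]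
  congr 1
  ext f n
  cases n <;> rfl

/-! ### The law of the weights of the tree and its decomposition at the root -/

/-- The variables attached to the vertices: `T (v, j)` is the `j`-th gap of the Poisson process
at `v`. -/
abbrev Tree := List ℕ × ℕ → ℝ

instance : IsProbabilityMeasure (expMeasure 1) := isProbabilityMeasure_expMeasure one_pos

/-- The law of the variables of the PWIT. -/
noncomputable def treeLaw : Measure Tree := Measure.infinitePi fun _ => expMeasure 1

instance : IsProbabilityMeasure treeLaw := by unfold treeLaw; infer_instance

/-- The subtree of descendants of the `i`-th child of the root. -/
def subtree (i : ℕ) (T : Tree) : Tree := fun p => T (p.1 ++ [i], p.2)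

/-- The gaps at the root together with the subtrees of the children of the root. -/
def branches (T : Tree) : ℕ → ℝ × Tree := fun i => (T ([], i), subtree i T)

@[fun_prop] lemma measurable_subtree (i : ℕ) : Measurable (subtree i) := by
  unfold subtree; fun_prop

@[fun_prop] lemma measurable_branches : Measurable branches := by
  unfold branches; fun_prop

/-- Self-similarity of the tree. Vertices list the most recent step first, so the descendants of
child `i` are the lists ending in `i`, and `g` is the resulting bijection between root gaps together
with subtree variables and all variables. -/
lemma map_branches_treeLaw :
    treeLaw.map branches = Measure.infinitePi fun _ : ℕ => (expMeasure 1).prod treeLaw := by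
  let g : ℕ × Option (List ℕ × ℕ) → List ℕ × ℕ := fun q => match q with
    | (i, none) => ([], i)
    | (i, some (v, j)) => (v ++ [i], j)
  have hg : Function.Bijective g := by
    constructor
    · rintro ⟨i, _ | ⟨v, j⟩⟩ ⟨i', _ | ⟨v', j'⟩⟩ h
      · simpa [g] using h
      · simp [g] at h
      · simp [g] at h
      · simp only [g, Prod.mk.injEq] at h
        obtain ⟨h1, rfl⟩ := h
        obtain ⟨rfl, h2⟩ := List.append_inj' h1 rfl
        simp_all
    · rintro ⟨v, j⟩
      rcases List.eq_nil_or_concat v with rfl | ⟨w, i, rfl⟩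
      · exact ⟨(j, none), rfl⟩
      · exact ⟨(i, some (w, j)), by simp [g]⟩
  have h1 := map_comp_equiv_infinitePi (expMeasure 1) (Equiv.ofBijective g hg)
  have h2 := Measure.infinitePi_map_curry (fun (_ : ℕ) (_ : Option (List ℕ × ℕ)) => expMeasure 1)
  have h3 := Measure.infinitePi_map_pi
    (fun _ : ℕ => Measure.infinitePi fun _ : Option (List ℕ × ℕ) => expMeasure 1)
    (f := fun _ f => (f none, fun k => f (some k))) (fun _ => by fun_prop)
  simp only [map_option_infinitePi] at h3
  rw [← h2, ← h1, Measure.map_map (by fun_prop) (by fun_prop),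
    Measure.map_map (by fun_prop) (by fun_prop)] at h3
  exact h3

/-! ### Marked Poisson processes and the Mecke formula -/

variable {M : Type*}

/-- The points of a marked process, from the gaps between consecutive positions and the marks. -/
def points (ξ : ℕ → ℝ × M) : ℕ → ℝ × M :=
  fun i => (∑ j ∈ Finset.range (i + 1), (ξ j).1, (ξ i).2)

/-- The sequence `c` without its `i`-th term. -/
def omitAt {X : Type*} (i : ℕ) (c : ℕ → X) : ℕ → X := fun j => if j < i then c j else c (j + 1)

/-- Translation of the position of a marked point. -/
def shift (e : ℝ) (p : ℝ × M) : ℝ × M := (e + p.1, p.2)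

lemma points_consSeq (p : ℝ × M) (ξ : ℕ → ℝ × M) :
    points (consSeq p ξ) = consSeq p (fun j => shift p.1 (points ξ j)) := by
  funext i
  cases i with
  | zero => simp [points]
  | succ n => simp [points, shift, Finset.sum_range_succ' _ (n + 1), add_comm p.1]

lemma omitAt_zero_consSeq {X : Type*} (a : X) (c : ℕ → X) : omitAt 0 (consSeq a c) = c := by
  funext j; simp [omitAt]

lemma omitAt_succ_consSeq {X : Type*} (i : ℕ) (a : X) (c : ℕ → X) :
    omitAt (i + 1) (consSeq a c) = consSeq a (omitAt i c) := by
  funext j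
  cases j <;> simp [omitAt]

/-- Deleting the first point merges the first two gaps into one of length `e + r`, which carries the
mark of the second point. This is the base case of the Mecke formula. -/
lemma points_consSeq_consSeq (e r : ℝ) (m m' : M) (ξ : ℕ → ℝ × M) :
    points (consSeq (e, m) (consSeq (r, m') ξ)) =
      consSeq (e, m) (points (consSeq (e + r, m') ξ)) := by
  simp only [points_consSeq]
  congr 1
  funext j
  cases j <;> simp [shift, add_assoc]

/-- The position `s` lies in the `i`-th gap of the process. -/
def InGap (i : ℕ) (s : ℝ) (ξ : ℕ → ℝ × M) : Prop :=
  ∑ j ∈ Finset.range i, (ξ j).1 < s ∧ s ≤ ∑ j ∈ Finset.range (i + 1), (ξ j).1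

lemma inGap_succ_consSeq (i : ℕ) (s : ℝ) (p : ℝ × M) (ξ : ℕ → ℝ × M) :
    InGap (i + 1) (p.1 + s) (consSeq p ξ) ↔ InGap i s ξ := by
  simp [InGap, add_comm p.1, Finset.sum_range_succ' _ (i + 1), Finset.sum_range_succ' _ i]

lemma inGap_zero_consSeq (s : ℝ) (p : ℝ × M) (ξ : ℕ → ℝ × M) :
    InGap 0 s (consSeq p ξ) ↔ 0 < s ∧ s ≤ p.1 := by
  simp [InGap]

variable [MeasurableSpace M]

/-- The law of the gaps and marks of a Poisson process of rate one with independent marks. -/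
noncomputable def gapLaw (ν : Measure M) : Measure (ℕ → ℝ × M) :=
  Measure.infinitePi fun _ => (expMeasure 1).prod ν

instance (ν : Measure M) [IsProbabilityMeasure ν] : IsProbabilityMeasure (gapLaw ν) := by
  unfold gapLaw; infer_instance

@[fun_prop] lemma measurable_points : Measurable (points : (ℕ → ℝ × M) → ℕ → ℝ × M) := by
  unfold points; fun_prop

@[fun_prop] lemma measurable_omitAt {X : Type*} [MeasurableSpace X] (i : ℕ) :
    Measurable (omitAt i : (ℕ → X) → ℕ → X) := by
  refine measurable_pi_lambda _ fun j => ?_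
  unfold omitAt
  split_ifs <;> fun_prop

lemma measurable_shift : Measurable fun q : ℝ × (ℝ × M) => shift q.1 q.2 := by
  unfold shift; fun_prop

@[fun_prop] lemma measurable_shift_of {Y : Type*} [MeasurableSpace Y] {f : Y → ℝ} {g : Y → ℝ × M}
    (hf : Measurable f) (hg : Measurable g) : Measurable fun y => shift (f y) (g y) :=
  measurable_shift.comp (hf.prodMk hg)

lemma measurableSet_inGap (i : ℕ) :
    MeasurableSet {q : ℝ × (ℕ → ℝ × M) | InGap i q.1 q.2} := by
  unfold InGap
  have h : ∀ n, Measurable fun q : ℝ × (ℕ → ℝ × M) => ∑ j ∈ Finset.range n, (q.2 j).1 :=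
    fun n => by fun_prop
  exact (measurableSet_lt (h i) measurable_fst).inter (measurableSet_le measurable_fst (h (i + 1)))

open scoped Classical in
/-- `H` evaluated at a marked point `q` in the `i`-th gap, and zero elsewhere. -/
noncomputable def gapTerm (H : (ℝ × M) × (ℕ → ℝ × M) → ENNReal) (i : ℕ) (q : ℝ × M)
    (ξ : ℕ → ℝ × M) : ENNReal :=
  if InGap i q.1 ξ then H (q, points ξ) else 0

lemma measurable_gapTerm {H : (ℝ × M) × (ℕ → ℝ × M) → ENNReal} (hH : Measurable H) (i : ℕ) :
    Measurable fun q : (ℝ × M) × (ℕ → ℝ × M) => gapTerm H i q.1 q.2 := by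
  unfold gapTerm
  refine Measurable.ite ?_ (by fun_prop) measurable_const
  exact (measurableSet_inGap i).preimage
    (f := fun q : (ℝ × M) × (ℕ → ℝ × M) => (q.1.1, q.2)) (by fun_prop)

lemma measurable_gapTerm_of {Y : Type*} [MeasurableSpace Y] {H : (ℝ × M) × (ℕ → ℝ × M) → ENNReal}
    (hH : Measurable H) (i : ℕ) {f : Y → ℝ × M} {g : Y → ℕ → ℝ × M} (hf : Measurable f)
    (hg : Measurable g) : Measurable fun y => gapTerm H i (f y) (g y) :=
  (measurable_gapTerm hH i).comp (hf.prodMk hg)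

lemma lintegral_gapLaw (ν : Measure M) [IsProbabilityMeasure ν] {f : (ℕ → ℝ × M) → ENNReal}
    (hf : Measurable f) :
    ∫⁻ ξ, f ξ ∂gapLaw ν =
      ∫⁻ p, ∫⁻ ξ, f (consSeq p ξ) ∂gapLaw ν ∂(expMeasure 1).prod ν := by
  conv_lhs => rw [gapLaw, ← map_consSeq]
  rw [lintegral_map hf (by fun_prop), lintegral_prod _ (by fun_prop)]
  rfl

lemma lintegral_expMeasure {f : ℝ → ENNReal} (hf : Measurable f) :
    ∫⁻ x, f x ∂expMeasure 1 = ∫⁻ x, exponentialPDF 1 x * f x :=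
  lintegral_withDensity_eq_lintegral_mul _ (measurable_exponentialPDFReal 1).ennreal_ofReal hf

/-- Memorylessness: the product of the exponentials does not depend on the splitting point `e`. The
null case `e = 0` is excluded because the density is `1` there, while the right side asks for `0 <
e`. -/
lemma exponentialPDF_mul_exponentialPDF_sub {e r : ℝ} (he : e ≠ 0) :
    exponentialPDF 1 e * exponentialPDF 1 (r - e) =
      if 0 < e ∧ e ≤ r then exponentialPDF 1 r else 0 := by
  simp only [exponentialPDF_eq]
  rcases lt_or_gt_of_ne he with h | h
  · simp [not_le.2 h, not_lt.2 h.le]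
  · by_cases h2 : e ≤ r
    · have h3 : 0 ≤ r := h.le.trans h2
      simp only [h.le, h, h2, sub_nonneg, if_true, one_mul, h3, and_self]
      rw [← ENNReal.ofReal_mul (Real.exp_nonneg _), ← Real.exp_add]
      congr 2; ring
    · simp [h2]

/-- Splitting a gap: the position and the remainder have the law of two consecutive gaps. -/
lemma lintegral_expMeasure_expMeasure {K : ℝ → ℝ → ENNReal} 
    (hK : Measurable fun p : ℝ × ℝ => K p.1 p.2) :
    ∫⁻ e, ∫⁻ r, K e (e + r) ∂expMeasure 1 ∂expMeasure 1 =
      ∫⁻ s, ∫⁻ r, (if 0 < s ∧ s ≤ r then K s r else 0) ∂expMeasure 1 := by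
  have hpdf : Measurable (exponentialPDF 1) := (measurable_exponentialPDFReal 1).ennreal_ofReal
  have hK1 : ∀ e, Measurable (K e) := fun e => hK.comp measurable_prodMk_left
  rw [lintegral_expMeasure (Measurable.lintegral_prod_right'
    (f := fun p : ℝ × ℝ => K p.1 (p.1 + p.2)) (by fun_prop))]
  refine lintegral_congr_ae ?_
  filter_upwards [Measure.ae_ne volume (0 : ℝ)] with e he
  rw [lintegral_expMeasure (by fun_prop), lintegral_expMeasure (by
      refine Measurable.ite ?_ (hK1 e) measurable_const
      exact (MeasurableSet.const (0 < e)).inter measurableSet_Ici),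
    ← lintegral_const_mul _ (by fun_prop),
    ← lintegral_sub_right_eq_self (
      fun r => exponentialPDF 1 e * (exponentialPDF 1 r * K e (e + r))) e]
  refine lintegral_congr fun r => ?_
  rw [← mul_assoc, exponentialPDF_mul_exponentialPDF_sub he, add_sub_cancel]
  split_ifs <;> simp

variable {M : Type*} [MeasurableSpace M]

lemma lintegral_shift (ν : Measure M) [IsProbabilityMeasure ν] {f : ℝ × M → ENNReal}
    (hf : Measurable f) (e : ℝ) :
    ∫⁻ q, f (shift e q) ∂(volume.prod ν) = ∫⁻ q, f q ∂(volume.prod ν) := by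
  rw [lintegral_prod _ (by fun_prop), lintegral_prod _ (by fun_prop)]
  exact lintegral_add_left_eq_self (fun s => ∫⁻ m, f (s, m) ∂ν) e

/-- The Mecke formula for the `i`-th point of a marked Poisson process. -/
lemma lintegral_omitAt (ν : Measure M) [IsProbabilityMeasure ν] (i : ℕ) :
    ∀ {H : (ℝ × M) × (ℕ → ℝ × M) → ENNReal}, Measurable H →
      ∫⁻ ξ, H (points ξ i, omitAt i (points ξ)) ∂gapLaw ν =
        ∫⁻ q, ∫⁻ ξ, gapTerm H i q ξ ∂gapLaw ν ∂(volume.prod ν) := by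
  induction i with
  | zero =>
    intro H hH
    -- The first point, at `s` with mark `m`, is set apart; `r` is the merged first gap of the
    -- remaining process. Both sides become integrals of `K` and are matched by splitting the gap
    -- `r` at `s`.
    let K : M → ℝ → ℝ → ENNReal := fun m s r =>
      ∫⁻ m', ∫⁻ ξ, H ((s, m), points (consSeq (r, m') ξ)) ∂gapLaw ν ∂ν
    have hK : Measurable fun p : M × ℝ × ℝ => K p.1 p.2.1 p.2.2 := by
      refine Measurable.lintegral_prod_right' (f := fun p : (M × ℝ × ℝ) × M =>
        ∫⁻ ξ, H ((p.1.2.1, p.1.1), points (consSeq (p.1.2.2, p.2) ξ)) ∂gapLaw ν) ?_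
      exact Measurable.lintegral_prod_right' (f := fun p : ((M × ℝ × ℝ) × M) × (ℕ → ℝ × M) =>
        H ((p.1.1.2.1, p.1.1.1), points (consSeq (p.1.1.2.2, p.1.2) p.2))) (by fun_prop)
    have h1 : ∀ e m, ∫⁻ ξ, H (points (consSeq (e, m) ξ) 0, omitAt 0 (points (consSeq (e, m) ξ)))
        ∂gapLaw ν = ∫⁻ r, K m e (e + r) ∂expMeasure 1 := by
      intro e m
      rw [lintegral_gapLaw ν (by fun_prop), lintegral_prod _ (Measurable.aemeasurable
        (Measurable.lintegral_prod_right' (f := fun p : (ℝ × M) × (ℕ → ℝ × M) =>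
          H (points (consSeq (e, m) (consSeq p.1 p.2)) 0,
            omitAt 0 (points (consSeq (e, m) (consSeq p.1 p.2))))) (by fun_prop)))]
      simp only [points_consSeq_consSeq, omitAt_zero_consSeq, consSeq_zero, K]
    have h2 : ∀ s m, ∫⁻ ξ, gapTerm H 0 (s, m) ξ ∂gapLaw ν =
        ∫⁻ r, (if 0 < s ∧ s ≤ r then K m s r else 0) ∂expMeasure 1 := by
      intro s m
      have hg := measurable_gapTerm hH 0
      rw [lintegral_gapLaw ν (f := gapTerm H 0 (s, m)) (hg.comp measurable_prodMk_left),
        lintegral_prod _ (Measurable.aemeasurable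
        (Measurable.lintegral_prod_right' (f := fun p : (ℝ × M) × (ℕ → ℝ × M) =>
          gapTerm H 0 (s, m) (consSeq p.1 p.2)) (measurable_gapTerm_of hH _ (by fun_prop) (by fun_prop))))]
      refine lintegral_congr fun r => ?_
      simp only [gapTerm, inGap_zero_consSeq, K]
      split_ifs <;> simp
    rw [lintegral_gapLaw ν (by fun_prop), lintegral_prod_symm _ (Measurable.aemeasurable
        (Measurable.lintegral_prod_right' (f := fun p : (ℝ × M) × (ℕ → ℝ × M) =>
          H (points (consSeq p.1 p.2) 0, omitAt 0 (points (consSeq p.1 p.2)))) (by fun_prop))),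
      lintegral_prod_symm _ (Measurable.aemeasurable
        (Measurable.lintegral_prod_right' (measurable_gapTerm hH 0)))]
    refine lintegral_congr fun m => ?_
    simp only [h1, h2]
    exact lintegral_expMeasure_expMeasure (hK.comp measurable_prodMk_left)
  | succ i ih =>
    intro H hH
    have hg := measurable_gapTerm hH (i + 1)
    rw [lintegral_gapLaw ν (by fun_prop)]
    have h1 : ∀ p, ∫⁻ ξ, H (points (consSeq p ξ) (i + 1), omitAt (i + 1) (points (consSeq p ξ)))
        ∂gapLaw ν = ∫⁻ q, ∫⁻ ξ, gapTerm H (i + 1) q (consSeq p ξ) ∂gapLaw ν ∂(volume.prod ν) := by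
      intro p
      -- With the first gap and mark `p` frozen, the rest is a process translated by `p.1`, and
      -- point `i + 1` is its point `i`. Translation invariance of `volume` absorbs the shift of the
      -- extra point.
      have h := ih (H := fun x : (ℝ × M) × (ℕ → ℝ × M) => H (shift p.1 x.1, consSeq p fun j => shift p.1 (x.2 j)))
        (by fun_prop)
      rw [← lintegral_shift ν (Measurable.lintegral_prod_right'
        (f := fun x : (ℝ × M) × (ℕ → ℝ × M) => gapTerm H (i + 1) x.1 (consSeq p x.2))
          (measurable_gapTerm_of hH _ (by fun_prop) (by fun_prop))) p.1]
      simp only [omitAt_succ_consSeq, points_consSeq, consSeq_succ]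
      refine Eq.trans (lintegral_congr fun ξ => ?_)
        (h.trans (lintegral_congr fun q => lintegral_congr fun ξ => ?_))
      · congr 3
        funext j
        simp only [omitAt]
        split_ifs <;> rfl
      · rw [gapTerm, gapTerm, points_consSeq]
        classical exact if_congr (inGap_succ_consSeq i q.1 p ξ).symm rfl rfl
    simp only [h1]
    rw [lintegral_lintegral_swap (f := fun p q => ∫⁻ ξ, gapTerm H (i + 1) q (consSeq p ξ) ∂gapLaw ν)]
    · refine lintegral_congr fun q => ?_
      exact (lintegral_gapLaw ν (f := gapTerm H (i + 1) q) (hg.comp measurable_prodMk_left)).symm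
    · refine Measurable.aemeasurable ?_
      exact Measurable.lintegral_prod_right'
        (f := fun x : ((ℝ × M) × (ℝ × M)) × (ℕ → ℝ × M) =>
          gapTerm H (i + 1) x.1.2 (consSeq x.1.1 x.2)) (measurable_gapTerm_of hH _ (by fun_prop) (by fun_prop))

lemma expMeasure_Iic_zero : expMeasure 1 (Iic 0) = 0 := by
  have h := ofReal_cdf (expMeasure 1) 0
  rw [cdf_expMeasure_eq one_pos] at h
  simpa using h.symm

lemma ae_expMeasure_pos : ∀ᵐ x ∂expMeasure 1, 0 < x := by
  rw [ae_iff]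
  simpa [not_lt, Iic] using expMeasure_Iic_zero

/-- Partial sums of independent exponential variables tend to infinity. -/
lemma ae_tendsto_sum_exp {Ω : Type*} [MeasurableSpace Ω] {P : Measure Ω} [IsProbabilityMeasure P]
    {X : ℕ → Ω → ℝ} (hX : ∀ j, MeasurePreserving (X j) P (expMeasure 1)) (hi : iIndepFun X P) :
    ∀ᵐ ω ∂P, Tendsto (fun n => ∑ j ∈ Finset.range (n + 1), X j ω) atTop atTop := by
  -- Truncation to `[0, 1]` makes integrability trivial and keeps the mean positive, which suffices
  -- for the strong law to force divergence.
  let φ : ℝ → ℝ := fun x => min 1 (max 0 x)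
  have hφ : Measurable φ := by fun_prop
  have hpos : ∀ j, ∀ᵐ ω ∂P, 0 < X j ω := fun j =>
    (hX j).quasiMeasurePreserving.ae ae_expMeasure_pos
  have hint : Integrable (fun ω => φ (X 0 ω)) P := by
    refine Integrable.of_bound (hφ.comp (hX 0).measurable).aestronglyMeasurable 1 ?_
    refine Eventually.of_forall fun ω => ?_
    rw [Real.norm_of_nonneg (by positivity)]
    exact min_le_left _ _
  have hlaw := strong_law_ae_real (fun j ω => φ (X j ω)) hint
    (fun i j hij => (hi.indepFun hij).comp hφ hφ) (fun j =>
      (⟨(hX j).aemeasurable, (hX 0).aemeasurable, (hX j).map_eq.trans (hX 0).map_eq.symm⟩ :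
        IdentDistrib (X j) (X 0) P P).comp hφ)
  have hm : 0 < P[fun ω => φ (X 0 ω)] := by
    rw [integral_pos_iff_support_of_nonneg (fun ω => by positivity) hint]
    refine lt_of_lt_of_eq one_pos ?_
    have hms : MeasurableSet (Function.support fun ω => φ (X 0 ω)) :=
      measurableSet_support (hφ.comp (hX 0).measurable)
    refine ((mem_ae_iff_prob_eq_one hms).1 ?_).symm
    filter_upwards [hpos 0] with ω h
    exact (lt_min one_pos (lt_max_of_lt_right h)).ne'
  filter_upwards [ae_all_iff.2 hpos, hlaw] with ω h1 h2
  have h3 : Tendsto (fun n : ℕ => (∑ j ∈ Finset.range n, φ (X j ω)) / n * n) atTop atTop :=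
    h2.pos_mul_atTop hm tendsto_natCast_atTop_atTop
  refine tendsto_atTop_mono (fun n => ?_) (h3.comp (tendsto_add_atTop_nat 1))
  simp only [Function.comp]
  rw [div_mul_cancel₀ _ (by positivity)]
  refine Finset.sum_le_sum fun j _ => ?_
  simp only [φ]
  rw [max_eq_right (h1 j).le]
  exact min_le_right _ _

/-- The gaps, as half-open intervals, partition the positive half-line, so exactly one term
survives. Summing `lintegral_omitAt` over `i` then yields the full Mecke formula. -/
lemma tsum_gapTerm {M : Type*} (H : (ℝ × M) × (ℕ → ℝ × M) → ENNReal) (q : ℝ × M) {ξ : ℕ → ℝ × M}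
    (hpos : ∀ j, 0 < (ξ j).1) (htop : Tendsto (fun n => (points ξ n).1) atTop atTop) :
    ∑' i, gapTerm H i q ξ = if 0 < q.1 then H (q, points ξ) else 0 := by
  classical
  let S : ℕ → ℝ := fun n => ∑ j ∈ Finset.range n, (ξ j).1
  have hS : StrictMono S := strictMono_nat_of_lt_succ fun n => by
    simp [S, Finset.sum_range_succ, hpos]
  have hS0 : S 0 = 0 := by simp [S]
  split_ifs with hq
  · have hex : ∃ n, q.1 ≤ S (n + 1) := (htop.eventually_ge_atTop q.1).exists
    have hi : InGap (Nat.find hex) q.1 ξ := by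
      refine ⟨?_, Nat.find_spec hex⟩
      rcases Nat.eq_zero_or_pos (Nat.find hex) with h0 | h0
      · rw [h0]; simpa using hq
      · have := Nat.find_min hex (show Nat.find hex - 1 < Nat.find hex by omega)
        rw [show Nat.find hex - 1 + 1 = Nat.find hex by omega] at this
        exact not_le.1 this
    rw [tsum_eq_single (Nat.find hex), gapTerm, if_pos hi]
    intro i hne
    rw [gapTerm, if_neg]
    rintro ⟨h1, h2⟩
    have h3 : S i < S (Nat.find hex + 1) := lt_of_lt_of_le h1 hi.2
    have h4 : S (Nat.find hex) < S (i + 1) := lt_of_lt_of_le hi.1 h2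
    rw [hS.lt_iff_lt] at h3 h4
    omega
  · refine ENNReal.tsum_eq_zero.2 fun i => ?_
    rw [gapTerm, if_neg]
    rintro ⟨h1, -⟩
    exact hq (lt_of_le_of_lt (hS0 ▸ hS.monotone (Nat.zero_le i)) h1)

variable {M : Type*} [MeasurableSpace M]

lemma measurePreserving_gap (ν : Measure M) [IsProbabilityMeasure ν] (j : ℕ) :
    MeasurePreserving (fun ξ : ℕ → ℝ × M => (ξ j).1) (gapLaw ν) (expMeasure 1) := by
  have h := (measurePreserving_fst (μ := expMeasure 1) (ν := ν)).comp
    (measurePreserving_eval_infinitePi (fun _ : ℕ => (expMeasure 1).prod ν) j)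
  exact h

lemma ae_gapLaw_pos (ν : Measure M) [IsProbabilityMeasure ν] :
    ∀ᵐ ξ ∂gapLaw ν, ∀ j, 0 < (ξ j).1 :=
  ae_all_iff.2 fun j => (measurePreserving_gap ν j).quasiMeasurePreserving.ae ae_expMeasure_pos

lemma ae_gapLaw_tendsto (ν : Measure M) [IsProbabilityMeasure ν] :
    ∀ᵐ ξ ∂gapLaw ν, Tendsto (fun n => (points ξ n).1) atTop atTop := by
  have h : iIndepFun (fun (j : ℕ) (ξ : ℕ → ℝ × M) => (ξ j).1) (gapLaw ν) :=
    iIndepFun_infinitePi (P := fun _ : ℕ => (expMeasure 1).prod ν)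
      (X := fun _ x => x.1) fun _ => measurable_fst
  exact ae_tendsto_sum_exp (measurePreserving_gap ν) h

/-- The law of the points of a Poisson process of rate one with independent marks. -/
noncomputable def pointLaw (ν : Measure M) : Measure (ℕ → ℝ × M) := (gapLaw ν).map points

instance (ν : Measure M) [IsProbabilityMeasure ν] : IsProbabilityMeasure (pointLaw ν) :=
  Measure.isProbabilityMeasure_map measurable_points.aemeasurable

/-- The Mecke formula for a marked Poisson process. -/
theorem mecke (ν : Measure M) [IsProbabilityMeasure ν]
    {H : (ℝ × M) × (ℕ → ℝ × M) → ENNReal} (hH : Measurable H) :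
    ∫⁻ c, ∑' i, H (c i, omitAt i c) ∂pointLaw ν =
      ∫⁻ q, ∫⁻ c, H (q, c) ∂pointLaw ν ∂((volume.restrict (Ioi 0)).prod ν) := by
  have hm : ∀ i, Measurable fun c : ℕ → ℝ × M => H (c i, omitAt i c) := fun i => by fun_prop
  have hr : (volume.restrict (Ioi (0 : ℝ))).prod ν =
      (volume.prod ν).restrict (Prod.fst ⁻¹' Ioi 0) := by
    rw [← Measure.restrict_univ (μ := ν), Measure.prod_restrict, Measure.restrict_univ,
      Set.prod_univ]
  have hin : Measurable fun q => ∫⁻ c, H (q, c) ∂pointLaw ν := hH.lintegral_prod_right'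
  rw [lintegral_tsum fun i => (hm i).aemeasurable, hr,
    ← lintegral_indicator (measurable_fst measurableSet_Ioi)]
  have h1 : ∀ i, ∫⁻ c, H (c i, omitAt i c) ∂pointLaw ν =
      ∫⁻ q, ∫⁻ ξ, gapTerm H i q ξ ∂gapLaw ν ∂(volume.prod ν) := fun i => by
    rw [pointLaw, lintegral_map (hm i) measurable_points, lintegral_omitAt ν i hH]
  simp only [h1]
  rw [← lintegral_tsum fun i => (measurable_gapTerm hH i).lintegral_prod_right'.aemeasurable]
  refine lintegral_congr fun q => ?_
  have hg : ∀ i, Measurable (gapTerm H i q) := fun i =>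
    (measurable_gapTerm hH i).comp measurable_prodMk_left
  refine (lintegral_tsum fun i => (hg i).aemeasurable).symm.trans ?_
  have h2 : ∫⁻ ξ, ∑' i, gapTerm H i q ξ ∂gapLaw ν =
      ∫⁻ ξ, (if 0 < q.1 then H (q, points ξ) else 0) ∂gapLaw ν := by
    refine lintegral_congr_ae ?_
    filter_upwards [ae_gapLaw_pos ν, ae_gapLaw_tendsto ν] with ξ h1 h2
    exact tsum_gapTerm H q h1 h2
  refine h2.trans ?_
  by_cases hq : 0 < q.1
  · simp only [hq, if_true, indicator, mem_preimage, mem_Ioi]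
    rw [pointLaw, lintegral_map (by fun_prop) measurable_points]
  · simp [hq, indicator]

/-! ### The recursion for valuations -/

section Bellman

variable {M : Type*}

/-- The value of the root when `c` lists the `d`-th powers of the lengths of the edges to the
children, with marks from which `h` computes the values of the children. -/
noncomputable def bellman (d θ : ℝ) (h : M → ℝ) (c : ℕ → ℝ × M) : ℝ :=
  sInf (insert (θ / 2)
    {x : ℝ | ∃ i : ℕ, (c i).1 ^ (1 / d) ≤ θ ∧ x = (c i).1 ^ (1 / d) - h (c i).2})

/-- The positions are positive and tend to infinity. -/
def GoodPoints (c : ℕ → ℝ × M) : Prop :=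
  (∀ i, 0 < (c i).1) ∧ Tendsto (fun i => (c i).1) atTop atTop

variable {d θ : ℝ} {h h' : M → ℝ} {c : ℕ → ℝ × M}

lemma GoodPoints.finite (hc : GoodPoints c) (hd : 1 ≤ d) (θ : ℝ) :
    {i | (c i).1 ^ (1 / d) ≤ θ}.Finite := by
  have h1 : Tendsto (fun i => (c i).1 ^ (1 / d)) atTop atTop :=
    (tendsto_rpow_atTop (by positivity)).comp hc.2
  have h2 := h1.eventually_gt_atTop θ
  rw [← Nat.cofinite_eq_atTop, eventually_cofinite] at h2
  simpa [not_lt] using h2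

lemma GoodPoints.omitAt (hc : GoodPoints c) (i : ℕ) : GoodPoints (omitAt i c) := by
  refine ⟨fun j => ?_, ?_⟩
  · unfold GraphExploration.omitAt
    split_ifs <;> exact hc.1 _
  · refine (hc.2.comp (tendsto_add_atTop_nat 1)).congr' ?_
    filter_upwards [eventually_ge_atTop i] with j hj
    simp [GraphExploration.omitAt, not_lt.2 hj]

lemma isLeast_bellman (hd : 1 ≤ d) (hc : GoodPoints c) (h : M → ℝ) :
    IsLeast (insert (θ / 2)
      {x : ℝ | ∃ i : ℕ, (c i).1 ^ (1 / d) ≤ θ ∧ x = (c i).1 ^ (1 / d) - h (c i).2})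
      (bellman d θ h c) := by
  have hfin : (insert (θ / 2)
      {x : ℝ | ∃ i : ℕ, (c i).1 ^ (1 / d) ≤ θ ∧ x = (c i).1 ^ (1 / d) - h (c i).2}).Finite := by
    refine Set.Finite.insert _ (((hc.finite hd θ).image
      fun i => (c i).1 ^ (1 / d) - h (c i).2).subset ?_)
    rintro x ⟨i, hi, rfl⟩
    exact ⟨i, hi, rfl⟩
  exact ⟨(insert_nonempty _ _).csInf_mem hfin, fun x hx => csInf_le hfin.bddBelow hx⟩

lemma bellman_le_half (hd : 1 ≤ d) (hc : GoodPoints c) : bellman d θ h c ≤ θ / 2 :=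
  (isLeast_bellman hd hc h).2 (mem_insert _ _)

lemma bellman_le (hd : 1 ≤ d) (hc : GoodPoints c) {i : ℕ} (hi : (c i).1 ^ (1 / d) ≤ θ) :
    bellman d θ h c ≤ (c i).1 ^ (1 / d) - h (c i).2 :=
  (isLeast_bellman hd hc h).2 (mem_insert_of_mem _ ⟨i, hi, rfl⟩)

lemma le_bellman_iff (hd : 1 ≤ d) (hc : GoodPoints c) {x : ℝ} :
    x ≤ bellman d θ h c ↔ x ≤ θ / 2 ∧
      ∀ i, (c i).1 ^ (1 / d) ≤ θ → x ≤ (c i).1 ^ (1 / d) - h (c i).2 := by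
  constructor
  · exact fun hx => ⟨hx.trans (bellman_le_half hd hc), fun i hi => hx.trans (bellman_le hd hc hi)⟩
  · rintro ⟨h1, h2⟩
    rcases (isLeast_bellman (θ := θ) hd hc h).1 with h3 | ⟨i, hi, h3⟩
    · rwa [h3]
    · rw [h3]; exact h2 i hi

lemma bellman_lt_iff (hd : 1 ≤ d) (hc : GoodPoints c) {x : ℝ} :
    bellman d θ h c < x ↔ θ / 2 < x ∨
      ∃ i, (c i).1 ^ (1 / d) ≤ θ ∧ (c i).1 ^ (1 / d) - h (c i).2 < x := by
  rw [← not_le, le_bellman_iff hd hc]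
  push Not
  constructor
  · intro h1
    by_cases h2 : x ≤ θ / 2
    · exact Or.inr (h1 h2)
    · exact Or.inl (not_le.1 h2)
  · rintro (h1 | h1) h2
    · exact absurd h1 (not_lt.2 h2)
    · exact h1

lemma bellman_anti (hd : 1 ≤ d) (hc : GoodPoints c) (hh : ∀ i, h (c i).2 ≤ h' (c i).2) :
    bellman d θ h' c ≤ bellman d θ h c :=
  (le_bellman_iff hd hc).2 ⟨bellman_le_half hd hc, fun _ hi =>
    (bellman_le hd hc hi).trans (sub_le_sub_left (hh _) _)⟩

lemma neg_half_le_bellman (hd : 1 ≤ d) (hθ : 0 ≤ θ) (hc : GoodPoints c)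
    (hh : ∀ i, h (c i).2 ≤ θ / 2) : -(θ / 2) ≤ bellman d θ h c :=
  (le_bellman_iff hd hc).2 ⟨by linarith, fun i _ => by
    have := Real.rpow_nonneg (hc.1 i).le (1 / d)
    linarith [hh i]⟩

/-- Only finitely many children are within distance `θ`, so this is continuity of a finite minimum;
no uniformity over the marks is needed. -/
lemma tendsto_bellman (hd : 1 ≤ d) (hc : GoodPoints c) {H : ℕ → M → ℝ}
    (hH : ∀ i, Tendsto (fun n => H n (c i).2) atTop (𝓝 (h (c i).2))) :
    Tendsto (fun n => bellman d θ (H n) c) atTop (𝓝 (bellman d θ h c)) := by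
  refine tendsto_order.2 ⟨fun a ha => ?_, fun a ha => ?_⟩
  · have h1 : ∀ᶠ n in atTop, ∀ i ∈ {i | (c i).1 ^ (1 / d) ≤ θ},
        a < (c i).1 ^ (1 / d) - H n (c i).2 := by
      rw [eventually_all_finite (hc.finite hd θ)]
      intro i hi
      exact (tendsto_const_nhds.sub (hH i)).eventually_const_lt (ha.trans_le (bellman_le hd hc hi))
    filter_upwards [h1] with n hn
    rcases (isLeast_bellman (θ := θ) hd hc (H n)).1 with h3 | ⟨i, hi, h3⟩
    · rw [h3]; exact ha.trans_le (bellman_le_half hd hc)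
    · rw [h3]; exact hn i hi
  · rcases (bellman_lt_iff hd hc).1 ha with h1 | ⟨i, hi, h1⟩
    · exact Eventually.of_forall fun n => (bellman_le_half hd hc).trans_lt h1
    · filter_upwards [(tendsto_const_nhds.sub (hH i)).eventually_lt_const h1] with n hn
      exact (bellman_le hd hc hi).trans_lt hn

/-- The value of the root is determined by one of the points and the value without it. -/
lemma bellman_eq_min_omitAt (hd : 1 ≤ d) (hc : GoodPoints c) {i : ℕ}
    (hi : (c i).1 ^ (1 / d) ≤ θ) :
    bellman d θ h c = min ((c i).1 ^ (1 / d) - h (c i).2) (bellman d θ h (omitAt i c)) := by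
  refine eq_of_forall_le_iff fun x => ?_
  rw [le_min_iff, le_bellman_iff hd hc, le_bellman_iff hd (hc.omitAt i)]
  constructor
  · rintro ⟨h1, h2⟩
    refine ⟨h2 i hi, h1, fun j hj => ?_⟩
    unfold omitAt at hj ⊢
    split_ifs at hj ⊢
    · exact h2 _ hj
    · exact h2 _ hj
  · rintro ⟨h1, h2, h3⟩
    refine ⟨h2, fun j hj => ?_⟩
    rcases lt_trichotomy j i with h4 | rfl | h4
    · simpa [omitAt, h4] using h3 j (by simpa [omitAt, h4] using hj)
    · exact h1
    · have h5 : ¬ j - 1 < i := by omega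
      have h6 : j - 1 + 1 = j := by omega
      simpa [omitAt, h5, h6] using h3 (j - 1) (by simpa [omitAt, h5, h6] using hj)

end Bellman

/-! ### Iterating the recursion -/

/-- The lengths of the edges. -/
noncomputable def len (d : ℝ) (T : Tree) : List ℕ → ℕ → ℝ :=
  fun v i => (∑ j ∈ Finset.range (i + 1), T (v, j)) ^ (1 / d)

/-- The subtree of descendants of the vertex `v`. -/
def subtreeAt (v : List ℕ) (T : Tree) : Tree := fun p => T (p.1 ++ v, p.2)

lemma subtreeAt_nil (T : Tree) : subtreeAt [] T = T := by
  funext p; simp [subtreeAt]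

lemma subtreeAt_cons (i : ℕ) (v : List ℕ) (T : Tree) :
    subtreeAt (i :: v) T = subtree i (subtreeAt v T) := by
  funext p; simp [subtreeAt, subtree]

/-- The children of the root, with the `d`-th powers of the lengths of the edges leading there. -/
def rootPoints (T : Tree) : ℕ → ℝ × Tree := points (branches T)

lemma rootPoints_subtreeAt_fst (d : ℝ) (v : List ℕ) (T : Tree) (i : ℕ) :
    (rootPoints (subtreeAt v T) i).1 ^ (1 / d) = len d T v i := by
  simp [rootPoints, points, branches, len, subtreeAt]

lemma rootPoints_subtreeAt_snd (v : List ℕ) (T : Tree) (i : ℕ) :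
    (rootPoints (subtreeAt v T) i).2 = subtreeAt (i :: v) T := by
  rw [subtreeAt_cons]; rfl

/-- The value of the root after `n` rounds of the recursion, from the constant `a` on. -/
noncomputable def iter (d θ a : ℝ) : ℕ → Tree → ℝ
  | 0, _ => a
  | n + 1, T => bellman d θ (iter d θ a n) (rootPoints T)

lemma propagate_len (d θ a : ℝ) (T : Tree) (n : ℕ) (v : List ℕ) :
    propagate (len d T) θ a n v = iter d θ a n (subtreeAt v T) := by
  induction n generalizing v with
  | zero => rfl
  | succ n ih =>
    simp only [propagate, iter, bellman, rootPoints_subtreeAt_fst, rootPoints_subtreeAt_snd, ih]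

/-- The gaps are positive and those at each vertex have infinite sum. -/
def GoodTree (T : Tree) : Prop :=
  (∀ e, 0 < T e) ∧
    ∀ v, Tendsto (fun n => ∑ j ∈ Finset.range (n + 1), T (v, j)) atTop atTop

lemma GoodTree.subtreeAt {T : Tree} (hT : GoodTree T) (v : List ℕ) :
    GoodTree (subtreeAt v T) :=
  ⟨fun _ => hT.1 _, fun w => hT.2 (w ++ v)⟩

lemma GoodTree.subtree {T : Tree} (hT : GoodTree T) (i : ℕ) : GoodTree (subtree i T) :=
  ⟨fun _ => hT.1 _, fun w => hT.2 (w ++ [i])⟩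

lemma GoodTree.goodPoints {T : Tree} (hT : GoodTree T) : GoodPoints (rootPoints T) :=
  ⟨fun i => Finset.sum_pos (s := Finset.range (i + 1)) (fun j _ => hT.1 ([], j)) (by simp), hT.2 []⟩

lemma GoodTree.snd {T : Tree} (hT : GoodTree T) (i : ℕ) : GoodTree (rootPoints T i).2 :=
  hT.subtree i

/-- The least and the greatest value of the root compatible with `n` rounds of the recursion. -/
noncomputable def bounds (d θ : ℝ) : ℕ → (Tree → ℝ) × (Tree → ℝ)
  | 0 => (fun _ => -(θ / 2), fun _ => θ / 2)
  | n + 1 => (fun T => bellman d θ (bounds d θ n).2 (rootPoints T),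
      fun T => bellman d θ (bounds d θ n).1 (rootPoints T))

/-- The least value of the root compatible with `n` rounds of the recursion. -/
noncomputable def lower (d θ : ℝ) (n : ℕ) : Tree → ℝ := (bounds d θ n).1

/-- The greatest value of the root compatible with `n` rounds of the recursion. -/
noncomputable def upper (d θ : ℝ) (n : ℕ) : Tree → ℝ := (bounds d θ n).2

/-- The limit of the lower bounds. -/
noncomputable def lowerLim (d θ : ℝ) (T : Tree) : ℝ := ⨆ n, lower d θ n T

/-- The limit of the upper bounds. -/
noncomputable def upperLim (d θ : ℝ) (T : Tree) : ℝ := ⨅ n, upper d θ n T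

section Iterate

variable {d θ : ℝ} {T : Tree}

lemma upper_succ (n : ℕ) (T : Tree) :
    upper d θ (n + 1) T = bellman d θ (lower d θ n) (rootPoints T) := rfl

lemma upper_le_half (hd : 1 ≤ d) (n : ℕ) (hT : GoodTree T) : upper d θ n T ≤ θ / 2 := by
  cases n with
  | zero => exact le_rfl
  | succ n => exact bellman_le_half hd hT.goodPoints

lemma neg_half_le_lower (hd : 1 ≤ d) (hθ : 0 ≤ θ) (n : ℕ) (hT : GoodTree T) :
    -(θ / 2) ≤ lower d θ n T := by
  cases n with
  | zero => exact le_rfl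
  | succ n =>
    exact neg_half_le_bellman hd hθ hT.goodPoints fun i => upper_le_half hd n (hT.snd i)

lemma lower_le_upper (hd : 1 ≤ d) (hθ : 0 ≤ θ) (n : ℕ) (hT : GoodTree T) :
    lower d θ n T ≤ upper d θ n T := by
  induction n generalizing T with
  | zero => show -(θ / 2) ≤ θ / 2; linarith
  | succ n ih => exact bellman_anti hd hT.goodPoints fun i => ih (hT.snd i)

lemma upper_anti_lower_mono (hd : 1 ≤ d) (hθ : 0 ≤ θ) (n : ℕ) (hT : GoodTree T) :
    upper d θ (n + 1) T ≤ upper d θ n T ∧ lower d θ n T ≤ lower d θ (n + 1) T := by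
  induction n generalizing T with
  | zero => exact ⟨upper_le_half hd 1 hT, neg_half_le_lower hd hθ 1 hT⟩
  | succ n ih =>
    exact ⟨bellman_anti hd hT.goodPoints fun i => (ih (hT.snd i)).2,
      bellman_anti hd hT.goodPoints fun i => (ih (hT.snd i)).1⟩

lemma upper_antitone (hd : 1 ≤ d) (hθ : 0 ≤ θ) (hT : GoodTree T) :
    Antitone fun n => upper d θ n T :=
  antitone_nat_of_succ_le fun n => (upper_anti_lower_mono hd hθ n hT).1

lemma lower_monotone (hd : 1 ≤ d) (hθ : 0 ≤ θ) (hT : GoodTree T) :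
    Monotone fun n => lower d θ n T :=
  monotone_nat_of_le_succ fun n => (upper_anti_lower_mono hd hθ n hT).2

lemma tendsto_upper (hd : 1 ≤ d) (hθ : 0 ≤ θ) (hT : GoodTree T) :
    Tendsto (fun n => upper d θ n T) atTop (𝓝 (upperLim d θ T)) := by
  refine tendsto_atTop_ciInf (upper_antitone hd hθ hT) ⟨-(θ / 2), ?_⟩
  rintro _ ⟨n, rfl⟩
  exact (neg_half_le_lower hd hθ n hT).trans (lower_le_upper hd hθ n hT)

lemma tendsto_lower (hd : 1 ≤ d) (hθ : 0 ≤ θ) (hT : GoodTree T) :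
    Tendsto (fun n => lower d θ n T) atTop (𝓝 (lowerLim d θ T)) := by
  refine tendsto_atTop_ciSup (lower_monotone hd hθ hT) ⟨θ / 2, ?_⟩
  rintro _ ⟨n, rfl⟩
  exact (lower_le_upper hd hθ n hT).trans (upper_le_half hd n hT)

/-- Because the operator reverses order, the limits are only known to be exchanged by it. Neither of
them is yet known to satisfy the recursion by itself. -/
lemma upperLim_eq (hd : 1 ≤ d) (hθ : 0 ≤ θ) (hT : GoodTree T) :
    upperLim d θ T = bellman d θ (lowerLim d θ) (rootPoints T) :=
  tendsto_nhds_unique ((tendsto_upper hd hθ hT).comp (tendsto_add_atTop_nat 1))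
    (tendsto_bellman hd hT.goodPoints fun i => tendsto_lower hd hθ (hT.snd i))

lemma lowerLim_eq (hd : 1 ≤ d) (hθ : 0 ≤ θ) (hT : GoodTree T) :
    lowerLim d θ T = bellman d θ (upperLim d θ) (rootPoints T) :=
  tendsto_nhds_unique ((tendsto_lower hd hθ hT).comp (tendsto_add_atTop_nat 1))
    (tendsto_bellman hd hT.goodPoints fun i => tendsto_upper hd hθ (hT.snd i))

lemma lowerLim_le_upperLim (hd : 1 ≤ d) (hθ : 0 ≤ θ) (hT : GoodTree T) :
    lowerLim d θ T ≤ upperLim d θ T :=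
  le_of_tendsto_of_tendsto' (tendsto_lower hd hθ hT) (tendsto_upper hd hθ hT)
    fun n => lower_le_upper hd hθ n hT

lemma upperLim_le_upper (hd : 1 ≤ d) (hθ : 0 ≤ θ) (hT : GoodTree T) (n : ℕ) :
    upperLim d θ T ≤ upper d θ n T :=
  (upper_antitone hd hθ hT).le_of_tendsto (tendsto_upper hd hθ hT) n

lemma upperLim_le_half (hd : 1 ≤ d) (hθ : 0 ≤ θ) (hT : GoodTree T) : upperLim d θ T ≤ θ / 2 :=
  upperLim_le_upper hd hθ hT 0

lemma neg_half_le_lowerLim (hd : 1 ≤ d) (hθ : 0 ≤ θ) (hT : GoodTree T) :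
    -(θ / 2) ≤ lowerLim d θ T :=
  (lower_monotone hd hθ hT).ge_of_tendsto (tendsto_lower hd hθ hT) 0

lemma iter_mem (hd : 1 ≤ d) {a : ℝ} (h1 : -(θ / 2) ≤ a) (h2 : a ≤ θ / 2) (n : ℕ)
    (hT : GoodTree T) : iter d θ a n T ∈ Icc (lower d θ n T) (upper d θ n T) := by
  induction n generalizing T with
  | zero => exact ⟨h1, h2⟩
  | succ n ih =>
    exact ⟨bellman_anti hd hT.goodPoints fun i => (ih (hT.snd i)).2,
      bellman_anti hd hT.goodPoints fun i => (ih (hT.snd i)).1⟩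

end Iterate

/-! ### Trees on which the bounds converge to the same limit -/

/-- The recursion started far below any vertex has a limit that does not depend on the start. -/
def Regular (d θ : ℝ) (T : Tree) : Prop :=
  GoodTree T ∧ ∀ v, lowerLim d θ (subtreeAt v T) = upperLim d θ (subtreeAt v T)

section Regular

variable {d θ : ℝ} {T : Tree}

/-- The start `a k` may vary with `k`, as the parity-dependent boundary values of `partialA` and
`partialB` require; the squeeze between `lower` and `upper` is indifferent to it. -/
lemma Regular.tendsto_propagate (hT : Regular d θ T) (hd : 1 ≤ d) (hθ : 0 ≤ θ) (v : List ℕ)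
    {a : ℕ → ℝ} (ha : ∀ k, a k ∈ Icc (-(θ / 2)) (θ / 2)) :
    Tendsto (fun k => propagate (len d T) θ (a k) (k - v.length) v) atTop
      (𝓝 (upperLim d θ (subtreeAt v T))) := by
  have hg := hT.1.subtreeAt v
  have h1 := (tendsto_lower hd hθ hg).comp (tendsto_sub_atTop_nat v.length)
  have h2 := (tendsto_upper hd hθ hg).comp (tendsto_sub_atTop_nat v.length)
  rw [hT.2 v] at h1
  simp only [propagate_len]
  exact tendsto_of_tendsto_of_tendsto_of_le_of_le h1 h2
    (fun k => (iter_mem hd (ha k).1 (ha k).2 _ hg).1)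
    (fun k => (iter_mem hd (ha k).1 (ha k).2 _ hg).2)

lemma Regular.tendsto_partialB (hT : Regular d θ T) (hd : 1 ≤ d) (hθ : 0 ≤ θ) (v : List ℕ) :
    Tendsto (fun k => partialB (len d T) θ k v) atTop (𝓝 (upperLim d θ (subtreeAt v T))) := by
  refine hT.tendsto_propagate hd hθ v (a := fun k => if Even k then θ / 2 else -(θ / 2))
    fun k => ?_
  split_ifs <;> constructor <;> linarith

lemma Regular.tendsto_partialA (hT : Regular d θ T) (hd : 1 ≤ d) (hθ : 0 ≤ θ) (v : List ℕ) :
    Tendsto (fun k => partialA (len d T) θ k v) atTop (𝓝 (upperLim d θ (subtreeAt v T))) := by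
  refine hT.tendsto_propagate hd hθ v (a := fun k => if Even k then -(θ / 2) else θ / 2)
    fun k => ?_
  split_ifs <;> constructor <;> linarith

lemma Regular.valueB_eq (hT : Regular d θ T) (hd : 1 ≤ d) (hθ : 0 ≤ θ) (v : List ℕ) :
    valueB (len d T) θ v = upperLim d θ (subtreeAt v T) :=
  (hT.tendsto_partialB hd hθ v).limUnder_eq

lemma Regular.valueA_eq (hT : Regular d θ T) (hd : 1 ≤ d) (hθ : 0 ≤ θ) (v : List ℕ) :
    valueA (len d T) θ v = upperLim d θ (subtreeAt v T) :=
  (hT.tendsto_partialA hd hθ v).limUnder_eq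

lemma Regular.upperLim_eq_bellman (hT : Regular d θ T) (hd : 1 ≤ d) (hθ : 0 ≤ θ) :
    upperLim d θ T = bellman d θ (upperLim d θ) (rootPoints T) := by
  conv_lhs => rw [← subtreeAt_nil T, ← hT.2 [], subtreeAt_nil]
  exact lowerLim_eq hd hθ hT.1

lemma Regular.subtreeAt (hT : Regular d θ T) (v : List ℕ) : Regular d θ (subtreeAt v T) := by
  refine ⟨hT.1.subtreeAt v, fun w => ?_⟩
  have : GraphExploration.subtreeAt w (GraphExploration.subtreeAt v T) =
      GraphExploration.subtreeAt (w ++ v) T := by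
    funext p; simp [GraphExploration.subtreeAt]
  rw [this, hT.2]

lemma Regular.isValuation (hT : Regular d θ T) (hd : 1 ≤ d) (hθ : 0 ≤ θ) :
    IsValuation (len d T) θ fun v => upperLim d θ (GraphExploration.subtreeAt v.1 T) := by
  intro v
  have h := isLeast_bellman (θ := θ) hd (hT.1.subtreeAt v.1).goodPoints (upperLim d θ)
  rw [← (hT.subtreeAt v.1).upperLim_eq_bellman hd hθ] at h
  simp only [rootPoints_subtreeAt_fst, rootPoints_subtreeAt_snd] at h
  convert! h using 3
  ext x
  exact ⟨fun ⟨i, hi, hx⟩ => ⟨i, hi.2, hx⟩, fun ⟨i, hi, hx⟩ => ⟨i, ⟨v.2, hi⟩, hx⟩⟩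

/-- A valuation takes values in `[-θ/2, θ/2]`, and each round of the order-reversing recursion
preserves the enclosure. Since `f` exists only on the cluster, the comparison is made through the
child attaining the minimum instead of `bellman_anti`. -/
lemma IsValuation.mem_Icc (hT : GoodTree T) (hd : 1 ≤ d) (hθ : 0 ≤ θ)
    {f : {v : List ℕ // cluster (len d T) θ v} → ℝ} (hf : IsValuation (len d T) θ f) (n : ℕ)
    (v : {v : List ℕ // cluster (len d T) θ v}) :
    f v ∈ Icc (lower d θ n (subtreeAt v.1 T)) (upper d θ n (subtreeAt v.1 T)) := by
  have hle : ∀ v, f v ≤ θ / 2 := fun v => (hf v).2 (mem_insert _ _)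
  induction n generalizing v with
  | zero =>
    refine ⟨?_, hle v⟩
    rcases (hf v).1 with h | ⟨i, hi, h⟩
    · rw [h]; show -(θ / 2) ≤ _; linarith
    · have h1 : 0 ≤ len d T v.1 i :=
        Real.rpow_nonneg (Finset.sum_nonneg fun j _ => (hT.1 _).le) _
      rw [h]; show -(θ / 2) ≤ _; linarith [hle ⟨i :: v.1, hi⟩]
  | succ n ih =>
    have hc := (hT.subtreeAt v.1).goodPoints
    constructor
    · rcases (hf v).1 with h | ⟨i, hi, h⟩
      · rw [h]; exact bellman_le_half hd hc
      · rw [h]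
        have := bellman_le (θ := θ) (h := upper d θ n) hd hc (i := i)
          (by rw [rootPoints_subtreeAt_fst]; exact hi.2)
        rw [rootPoints_subtreeAt_fst, rootPoints_subtreeAt_snd] at this
        exact this.trans (sub_le_sub_left (ih ⟨i :: v.1, hi⟩).2 _)
    · rcases (isLeast_bellman (θ := θ) hd hc (lower d θ n)).1 with h | ⟨i, hi, h⟩
      · rw [upper_succ, h]; exact hle v
      · rw [upper_succ, h, rootPoints_subtreeAt_fst, rootPoints_subtreeAt_snd]
        rw [rootPoints_subtreeAt_fst] at hi
        have h2 : cluster (len d T) θ (i :: v.1) := ⟨v.2, hi⟩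
        exact ((hf v).2 (mem_insert_of_mem _ ⟨i, h2, rfl⟩)).trans
          (sub_le_sub_left (ih ⟨i :: v.1, h2⟩).1 _)

lemma Regular.existsUnique_valuation (hT : Regular d θ T) (hd : 1 ≤ d) (hθ : 0 ≤ θ) :
    ∃! f : {v : List ℕ // cluster (len d T) θ v} → ℝ, IsValuation (len d T) θ f := by
  refine ⟨_, hT.isValuation hd hθ, fun f hf => funext fun v => ?_⟩
  have hg := hT.1.subtreeAt v.1
  refine le_antisymm (ge_of_tendsto' (tendsto_upper hd hθ hg)
    fun n => (IsValuation.mem_Icc hT.1 hd hθ hf n v).2) ?_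
  rw [← hT.2]
  exact le_of_tendsto' (tendsto_lower hd hθ hg)
    fun n => (IsValuation.mem_Icc hT.1 hd hθ hf n v).1

end Regular

/-! ### Transfer to the canonical space -/

lemma measurePreserving_subtree (i : ℕ) : MeasurePreserving (subtree i) treeLaw treeLaw := by
  have h1 : MeasurePreserving branches treeLaw (gapLaw treeLaw) :=
    ⟨measurable_branches, map_branches_treeLaw⟩
  have h2 := (measurePreserving_snd (μ := expMeasure 1) (ν := treeLaw)).comp
    (measurePreserving_eval_infinitePi (fun _ : ℕ => (expMeasure 1).prod treeLaw) i)
  exact h2.comp h1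

lemma measurePreserving_subtreeAt (v : List ℕ) :
    MeasurePreserving (subtreeAt v) treeLaw treeLaw := by
  induction v with
  | nil =>
    have : subtreeAt [] = id := funext subtreeAt_nil
    rw [this]; exact MeasurePreserving.id _
  | cons i v ih =>
    have : subtreeAt (i :: v) = subtree i ∘ subtreeAt v := funext (subtreeAt_cons i v)
    rw [this]; exact (measurePreserving_subtree i).comp ih

/-- The distributional recursion behind everything probabilistic: the marks of the Poisson process
at the root have the law of the tree itself. -/
lemma map_rootPoints_treeLaw : treeLaw.map rootPoints = pointLaw treeLaw := by
  rw [pointLaw, gapLaw, ← map_branches_treeLaw,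
    Measure.map_map measurable_points measurable_branches]
  rfl

lemma measurable_rootPoints : Measurable rootPoints := measurable_points.comp measurable_branches

lemma ae_goodTree : ∀ᵐ T ∂treeLaw, GoodTree T := by
  have h1 : ∀ e, MeasurePreserving (fun T : Tree => T e) treeLaw (expMeasure 1) :=
    fun e => measurePreserving_eval_infinitePi (fun _ : List ℕ × ℕ => expMeasure 1) e
  have h2 : iIndepFun (fun (e : List ℕ × ℕ) (T : Tree) => T e) treeLaw :=
    iIndepFun_infinitePi (P := fun _ : List ℕ × ℕ => expMeasure 1) (X := fun _ x => x)
      fun _ => measurable_id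
  refine Filter.Eventually.and ?_ ?_
  · exact ae_all_iff.2 fun e => (h1 e).quasiMeasurePreserving.ae ae_expMeasure_pos
  · refine ae_all_iff.2 fun v => ?_
    exact ae_tendsto_sum_exp (fun j => h1 (v, j))
      (h2.precomp (g := fun j : ℕ => (v, j)) fun i j h => by simpa using h)

/-- The PWIT, as a measure preserving map to the canonical space. -/
lemma IsPWIT.exists_measurePreserving {d : ℝ} {Ω : Type u} [MeasurableSpace Ω] {P : Measure Ω}
    [IsProbabilityMeasure P] {ℓ : Ω → List ℕ → ℕ → ℝ} (h : IsPWIT d P ℓ) :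
    ∃ X : Ω → Tree, MeasurePreserving X P treeLaw ∧ ∀ ω, ℓ ω = len d (X ω) := by
  obtain ⟨E, hE, hlaw, hind, hℓ⟩ := h
  refine ⟨fun ω e => E e ω, ⟨measurable_pi_lambda _ hE, ?_⟩, fun ω => ?_⟩
  · rw [(iIndepFun_iff_map_fun_eq_infinitePi_map hE).1 hind]
    simp only [hlaw]
    rfl
  · funext v i
    exact hℓ ω v i

/-! ### The distribution of the value of the root -/

lemma tsum_omitAt {X : Type*} (f : X → ENNReal) (i : ℕ) (c : ℕ → X) :
    ∑' j, f (c j) = f (c i) + ∑' j, f (omitAt i c j) := by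
  let e : ℕ → ℕ := fun j => if j < i then j else j + 1
  have he : Function.Injective e := by
    intro a b h
    simp only [e] at h
    split_ifs at h <;> omega
  let g : ℕ → ENNReal := fun j => if j = i then 0 else f (c j)
  have hg : Function.support g ⊆ Set.range e := by
    intro j hj
    have h1 : j ≠ i := by rintro rfl; simp [g] at hj
    rcases lt_or_gt_of_ne h1 with h2 | h2
    · exact ⟨j, by simp [e, h2]⟩
    · refine ⟨j - 1, ?_⟩
      simp only [e]
      split_ifs <;> omega
  have h3 : ∑' j, f (c j) = f (c i) + ∑' j, g j :=
    (ENNReal.tsum_eq_add_tsum_ite (f := fun j => f (c j)) i).trans <|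
      congrArg _ <| tsum_congr fun j => by simp only [g]; split_ifs <;> rfl
  have h4 : ∀ j, g (e j) = f (omitAt i c j) := by
    intro j
    have h5 : e j ≠ i := by simp only [e]; split_ifs <;> omega
    simp only [g, if_neg h5, e, omitAt]
    split_ifs <;> rfl
  rw [h3, ← he.tsum_eq hg]
  simp only [h4]

section Void

variable {M : Type*} {B : Set (ℝ × M)}

open scoped Classical in
/-- The number of points in `B`. -/
noncomputable def countIn (B : Set (ℝ × M)) (c : ℕ → ℝ × M) : ENNReal :=
  ∑' i, B.indicator 1 (c i)

/-- Needed in order that the probabilities of the finite counts add up to one. -/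
lemma exists_countIn_eq {c : ℕ → ℝ × M} (h : countIn B c ≠ ⊤) : ∃ n : ℕ, countIn B c = n := by
  have h1 : countIn B c = ({i | c i ∈ B}.encard : ℕ∞) := by
    rw [← ENNReal.tsum_set_one, tsum_subtype {i | c i ∈ B} fun _ => (1 : ENNReal)]
    rfl
  rw [h1] at h ⊢
  lift {i | c i ∈ B}.encard to ℕ using (by rintro h2; simp [h2] at h) with n
  exact ⟨n, rfl⟩

variable [MeasurableSpace M]

lemma measurable_countIn (hB : MeasurableSet B) : Measurable (countIn B) := by
  unfold countIn
  exact Measurable.tsum fun i => (measurable_one.indicator hB).comp (measurable_pi_apply i)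

/-- A Poisson process of rate one with independent marks has no points in a set of finite
measure `λ` with probability `exp (-λ)`. -/
theorem pointLaw_void (ν : Measure M) [IsProbabilityMeasure ν] (hB : MeasurableSet B)
    (hfin : ((volume.restrict (Ioi 0)).prod ν) B ≠ ⊤) :
    pointLaw ν {c | ∀ i, c i ∉ B} =
      ENNReal.ofReal (Real.exp (-(((volume.restrict (Ioi 0)).prod ν) B).toReal)) := by
  set lam := ((volume.restrict (Ioi 0)).prod ν) B with hlam
  have hN := measurable_countIn hB
  have hNk : ∀ k : ℕ, MeasurableSet {c | countIn B c = k} := fun k => hN (measurableSet_singleton _)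
  have hEN : ∫⁻ c, countIn B c ∂pointLaw ν = lam := by
    have := mecke ν (H := fun x => B.indicator 1 x.1)
      ((measurable_one.indicator hB).comp measurable_fst)
    simp only [lintegral_const, measure_univ, mul_one] at this
    rw [lintegral_indicator_one hB] at this
    exact this
  have hNtop : ∀ᵐ c ∂pointLaw ν, countIn B c < ⊤ :=
    ae_lt_top hN (hEN ▸ hfin)
  let p : ℕ → ENNReal := fun k => pointLaw ν {c | countIn B c = k}
  -- The Mecke formula applied to "the point lies in `B` and exactly `k` other points do". On the
  -- event of `k + 1` points in `B` there are `k + 1` choices of the point. This recursion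
  -- characterizes the Poisson distribution up to normalization.
  have hrec : ∀ k : ℕ, (k + 1 : ENNReal) * p (k + 1) = lam * p k := by
    intro k
    have h := mecke ν (H := fun x => B.indicator 1 x.1 * {c | countIn B c = k}.indicator 1 x.2)
      (((measurable_one.indicator hB).comp measurable_fst).mul
        ((measurable_one.indicator (hNk k)).comp measurable_snd))
    have h1 : ∀ c : ℕ → ℝ × M, ∑' i, B.indicator (1 : ℝ × M → ENNReal) (c i) *
        {c | countIn B c = k}.indicator 1 (omitAt i c) =
        (k + 1 : ENNReal) * {c | countIn B c = (k + 1 : ℕ)}.indicator 1 c := by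
      intro c
      have h2 : ∀ i, B.indicator (1 : ℝ × M → ENNReal) (c i) *
          {c | countIn B c = k}.indicator 1 (omitAt i c) = B.indicator (1 : ℝ × M → ENNReal) (c i) *
            {c | countIn B c = (k + 1 : ℕ)}.indicator 1 c := by
        intro i
        by_cases hi : c i ∈ B
        · have h3 : countIn B c = 1 + countIn B (omitAt i c) := by
            rw [countIn, tsum_omitAt _ i c]
            simp [hi, countIn]
          have h4 : countIn B (omitAt i c) = k ↔ countIn B c = (k + 1 : ℕ) := by
            rw [h3, add_comm, Nat.cast_add, Nat.cast_one]
            exact (ENNReal.add_left_inj ENNReal.one_ne_top).symm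
          simp only [indicator, Set.mem_ofPred_eq, h4, Pi.one_apply]
        · simp [hi]
      simp only [h2]
      rw [ENNReal.tsum_mul_right]
      by_cases hc : countIn B c = (k + 1 : ℕ)
      · have h5 : ∑' i, B.indicator (1 : ℝ × M → ENNReal) (c i) = (k + 1 : ℕ) := hc
        rw [h5]; simp
      · simp only [indicator, Set.mem_ofPred_eq, hc, if_false, mul_zero]
    simp only [h1] at h
    rw [lintegral_const_mul _ (measurable_one.indicator (hNk (k + 1))),
      lintegral_indicator_one (hNk (k + 1))] at h
    rw [show p (k + 1) = pointLaw ν {c | countIn B c = (k + 1 : ℕ)} from rfl, h]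
    simp_rw [lintegral_const_mul _ (measurable_one.indicator (hNk k)),
      lintegral_indicator_one (hNk k)]
    rw [lintegral_mul_const _ (measurable_one.indicator hB), lintegral_indicator_one hB]
  have hp : ∀ k, p k ≠ ⊤ := fun k => measure_ne_top _ _
  have hreal : ∀ k, (p k).toReal = lam.toReal ^ k / k.factorial * (p 0).toReal := by
    intro k
    induction k with
    | zero => simp
    | succ k ih =>
      have h := congrArg ENNReal.toReal (hrec k)
      rw [ENNReal.toReal_mul, ENNReal.toReal_mul, ih,
        show ((k : ENNReal) + 1).toReal = k + 1 by
          rw [ENNReal.toReal_add (by simp) (by simp)]; simp] at h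
      have h2 : (k : ℝ) + 1 ≠ 0 := by positivity
      rw [Nat.factorial_succ, pow_succ]
      push_cast
      field_simp at h ⊢
      linarith
  have hsum : ∑' k, p k = 1 := by
    rw [← measure_iUnion (fun i j hij => ?_) hNk]
    · rw [← mem_ae_iff_prob_eq_one (MeasurableSet.iUnion hNk)]
      filter_upwards [hNtop] with c hc
      obtain ⟨n, hn⟩ := exists_countIn_eq hc.ne
      exact mem_iUnion.2 ⟨n, hn⟩
    · refine Set.disjoint_left.2 fun c h1 h2 => hij ?_
      have h3 : (i : ENNReal) = j := (show countIn B c = i from h1).symm.trans h2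
      exact_mod_cast h3
  -- Total mass one fixes the normalization, the exponential series being the sum of the weights.
  have h1 : Real.exp lam.toReal * (p 0).toReal = 1 := by
    have h2 : ∑' k, (p k).toReal = 1 := by
      rw [← ENNReal.tsum_toReal_eq hp, hsum, ENNReal.toReal_one]
    rw [tsum_congr hreal, tsum_mul_right] at h2
    rwa [Real.exp_eq_exp_ℝ, NormedSpace.exp_eq_tsum_div]
  have h2 : {c : ℕ → ℝ × M | ∀ i, c i ∉ B} = {c | countIn B c = (0 : ℕ)} := by
    refine Set.ext fun c => ?_
    show (∀ i, c i ∉ B) ↔ countIn B c = ((0 : ℕ) : ENNReal)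
    rw [Nat.cast_zero, countIn, ENNReal.tsum_eq_zero]
    refine forall_congr' fun i => ⟨fun h => indicator_of_notMem h _, fun h hi => ?_⟩
    rw [indicator_of_mem hi] at h
    exact one_ne_zero h
  rw [h2, show pointLaw ν {c | countIn B c = (0 : ℕ)} = p 0 from rfl,
    ← ENNReal.ofReal_toReal (hp 0), Real.exp_neg, eq_inv_of_mul_eq_one_right h1]

end Void

/-- Written as an infimum over a fixed countable index set, the value is visibly measurable.
Children beyond distance `θ` contribute the harmless default `θ / 2`. -/
lemma bellman_eq_iInf {M : Type*} (d θ : ℝ) (h : M → ℝ) (c : ℕ → ℝ × M) :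
    bellman d θ h c = ⨅ o : Option ℕ, o.elim (θ / 2) fun i =>
      if (c i).1 ^ (1 / d) ≤ θ then (c i).1 ^ (1 / d) - h (c i).2 else θ / 2 := by
  rw [bellman, iInf]
  congr 1
  ext x
  constructor
  · rintro (rfl | ⟨i, hi, rfl⟩)
    · exact ⟨none, rfl⟩
    · exact ⟨some i, by simp only [Option.elim, if_pos hi]⟩
  · rintro ⟨_ | i, rfl⟩
    · exact mem_insert _ _
    · simp only [Option.elim]
      split_ifs with hi
      · exact mem_insert_of_mem _ ⟨i, hi, rfl⟩
      · exact mem_insert _ _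

variable {M : Type*} [MeasurableSpace M]

lemma ae_goodPoints (ν : Measure M) [IsProbabilityMeasure ν] :
    ∀ᵐ c ∂pointLaw ν, GoodPoints c := by
  have hS : MeasurableSet {c : ℕ → ℝ × M | GoodPoints c} := by
    have h1 : MeasurableSet {c : ℕ → ℝ × M | ∀ i, 0 < (c i).1} := by
      rw [ofPred_forall]
      exact MeasurableSet.iInter fun i =>
        (measurable_fst.comp (measurable_pi_apply i)) measurableSet_Ioi
    have h2 : MeasurableSet {c : ℕ → ℝ × M | Tendsto (fun i => (c i).1) atTop atTop} :=
      measurableSet_tendsto atTop fun i => measurable_fst.comp (measurable_pi_apply i)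
    exact h1.inter h2
  rw [pointLaw, ae_map_iff measurable_points.aemeasurable hS]
  filter_upwards [ae_gapLaw_pos ν, ae_gapLaw_tendsto ν] with ξ h1 h2
  exact ⟨fun i => Finset.sum_pos (s := Finset.range (i + 1)) (fun j _ => h1 j) (by simp), h2⟩

section Bellman

variable {d θ : ℝ} {h h' : M → ℝ}

lemma measurable_bellman (hh : Measurable h) : Measurable (bellman d θ h) := by
  have : bellman d θ h = fun c => _ := funext (bellman_eq_iInf d θ h)
  rw [this]
  refine Measurable.iInf fun o => ?_
  cases o with
  | none => exact measurable_const
  | some i =>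
    refine Measurable.ite ?_ (by fun_prop) measurable_const
    exact measurableSet_le (by fun_prop) measurable_const

/-- The value proposed to the root by a child. -/
noncomputable def offer (d : ℝ) (h : M → ℝ) (q : ℝ × M) : ℝ := q.1 ^ (1 / d) - h q.2

lemma measurable_offer (hh : Measurable h) : Measurable (offer d h) := by
  unfold offer; fun_prop

lemma volume_rpow_lt (hd : 1 ≤ d) (t : ℝ) :
    (volume.restrict (Ioi 0)) {s : ℝ | s ^ (1 / d) < t} = ENNReal.ofReal (max 0 t ^ d) := by
  have hd0 : 0 < d := by linarith
  rw [Measure.restrict_apply (measurableSet_lt (by fun_prop) measurable_const)]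
  rcases le_or_gt t 0 with ht | ht
  · rw [max_eq_left ht, Real.zero_rpow hd0.ne', ENNReal.ofReal_zero]
    convert measure_empty (μ := volume)
    refine eq_empty_of_forall_notMem fun s hs => ?_
    exact absurd (hs.1.trans_le ht) (not_lt.2 (Real.rpow_nonneg hs.2.le _))
  · rw [max_eq_right ht.le]
    have : {s : ℝ | s ^ (1 / d) < t} ∩ Ioi 0 = Ioo 0 (t ^ d) := by
      ext s
      constructor
      · rintro ⟨h1, h2⟩
        refine ⟨h2, ?_⟩
        rwa [Set.mem_ofPred_eq, one_div, Real.rpow_inv_lt_iff_of_pos h2.le ht.le hd0] at h1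
      · rintro ⟨h1, h2⟩
        refine ⟨?_, h1⟩
        rwa [Set.mem_ofPred_eq, one_div, Real.rpow_inv_lt_iff_of_pos h1.le ht.le hd0]
    rw [this, Real.volume_Ioo, sub_zero]

lemma volume_rpow_eq (hd : 1 ≤ d) (t : ℝ) :
    (volume.restrict (Ioi 0)) {s : ℝ | s ^ (1 / d) = t} = 0 := by
  rw [Measure.restrict_apply' measurableSet_Ioi]
  refine Set.Subsingleton.measure_zero ?_ _
  rintro a ⟨h1, h2⟩ b ⟨h3, h4⟩
  exact Real.rpow_left_injOn (x := 1 / d) (by positivity) (mem_Ioi.1 h2).le (mem_Ioi.1 h4).le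
    (h1.trans h3.symm)

/-- The distribution of the value of the root in terms of that of the values of the children. -/
theorem pointLaw_le_bellman (ν : Measure M) [IsProbabilityMeasure ν] (hd : 1 ≤ d)
    (hh : Measurable h) (hle : ∀ᵐ m ∂ν, h m ≤ θ / 2) {x : ℝ} (hx : x ≤ θ / 2) :
    (∫⁻ m, ENNReal.ofReal (max 0 (x + h m) ^ d) ∂ν ≠ ⊤) ∧
    pointLaw ν {c | x ≤ bellman d θ h c} = ENNReal.ofReal
      (Real.exp (-(∫⁻ m, ENNReal.ofReal (max 0 (x + h m) ^ d) ∂ν).toReal)) := by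
  have hd0 : 0 ≤ d := by linarith
  -- The value is at least `x ≤ θ / 2` exactly when no point falls in `B`, so its distribution is a
  -- void probability.
  let B : Set (ℝ × M) := {q | q.1 ^ (1 / d) ≤ θ ∧ offer d h q < x}
  have hB : MeasurableSet B := by
    have h1 : Measurable fun q : ℝ × M => q.1 ^ (1 / d) := by fun_prop
    exact (h1 measurableSet_Iic).inter (measurable_offer hh measurableSet_Iio)
  have hlam : ((volume.restrict (Ioi 0)).prod ν) B =
      ∫⁻ m, ENNReal.ofReal (max 0 (x + h m) ^ d) ∂ν := by
    rw [Measure.prod_apply_symm hB]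
    refine lintegral_congr_ae ?_
    filter_upwards [hle] with m hm
    rw [← volume_rpow_lt hd]
    congr 1
    ext s
    simp only [B, offer, mem_preimage, Set.mem_ofPred_eq]
    constructor
    · rintro ⟨-, h2⟩; linarith
    -- The cutoff at `θ` is automatic: an offer below `x ≤ θ / 2` from a mark with `h m ≤ θ / 2` has
    -- length less than `θ`.
    · intro h2; constructor <;> linarith
  have hfin : ∫⁻ m, ENNReal.ofReal (max 0 (x + h m) ^ d) ∂ν ≠ ⊤ := by
    refine ne_top_of_le_ne_top (b := ENNReal.ofReal (max 0 θ ^ d)) ENNReal.ofReal_ne_top ?_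
    calc _ ≤ ∫⁻ _, ENNReal.ofReal (max 0 θ ^ d) ∂ν := by
          refine lintegral_mono_ae ?_
          filter_upwards [hle] with m hm
          refine ENNReal.ofReal_le_ofReal (Real.rpow_le_rpow (le_max_left _ _) ?_ hd0)
          exact max_le_max le_rfl (by linarith)
      _ = _ := by simp
  refine ⟨hfin, ?_⟩
  rw [← hlam, ← pointLaw_void ν hB (hlam ▸ hfin)]
  refine measure_congr ?_
  filter_upwards [ae_goodPoints ν] with c hc
  refine propext ?_
  show x ≤ bellman d θ h c ↔ ∀ i, c i ∉ B
  rw [le_bellman_iff hd hc]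
  simp only [hx, true_and, B, Set.mem_ofPred_eq, not_and, not_lt, offer]

/-- Almost surely no two offers coincide. -/
lemma ae_offer_ne (ν : Measure M) [IsProbabilityMeasure ν] (hd : 1 ≤ d) (hh : Measurable h) :
    ∀ᵐ c ∂pointLaw ν, ∀ i j, offer d h (c i) ≠ offer d h (omitAt i c j) := by
  have hz := measurable_offer (d := d) hh
  let D : ℕ → Set ((ℝ × M) × (ℕ → ℝ × M)) := fun j => {x | offer d h x.1 = offer d h (x.2 j)}
  have hD : ∀ j, MeasurableSet (D j) := fun j =>
    measurableSet_eq_fun (hz.comp measurable_fst)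
      (hz.comp ((measurable_pi_apply j).comp measurable_snd))
  have hm : Measurable fun x => ∑' j, (D j).indicator (1 : (ℝ × M) × (ℕ → ℝ × M) → ENNReal) x :=
    Measurable.tsum fun j => measurable_one.indicator (hD j)
  have h1 := mecke ν hm
  have h2 : ∀ c : ℕ → ℝ × M, ∀ m, ∀ᵐ s ∂(volume.restrict (Ioi (0 : ℝ))),
      ∑' j, (D j).indicator (1 : (ℝ × M) × (ℕ → ℝ × M) → ENNReal) ((s, m), c) = 0 := by
    intro c m
    -- By Mecke the extra point is independent of the others and has a diffuse position, so it
    -- avoids the countably many positions that would create a tie.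
    have h3 : ∀ᵐ s ∂(volume.restrict (Ioi (0 : ℝ))), ∀ j, s ^ (1 / d) ≠ h m + offer d h (c j) := by
      refine ae_all_iff.2 fun j => ?_
      rw [ae_iff]
      simpa using volume_rpow_eq hd (h m + offer d h (c j))
    filter_upwards [h3] with s hs
    refine ENNReal.tsum_eq_zero.2 fun j => ?_
    rw [indicator_of_notMem]
    intro h4
    have h5 : s ^ (1 / d) - h m = offer d h (c j) := h4
    exact hs j (by linarith)
  rw [lintegral_lintegral_swap hm.aemeasurable] at h1
  have h6 : ∀ c : ℕ → ℝ × M, ∫⁻ q, ∑' j, (D j).indicator (1 : (ℝ × M) × (ℕ → ℝ × M) → ENNReal) (q, c)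
      ∂(volume.restrict (Ioi (0 : ℝ))).prod ν = 0 := by
    intro c
    have h7 : Measurable fun q : ℝ × M => ∑' j, (D j).indicator
        (1 : (ℝ × M) × (ℕ → ℝ × M) → ENNReal) (q, c) := hm.comp measurable_prodMk_right
    rw [lintegral_prod_symm _ h7.aemeasurable]
    simp [fun m => lintegral_congr_ae (h2 c m)]
  simp only [h6, lintegral_zero] at h1
  have h8 : Measurable fun c : ℕ → ℝ × M => ∑' i, ∑' j, (D j).indicator
      (1 : (ℝ × M) × (ℕ → ℝ × M) → ENNReal) (c i, omitAt i c) :=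
    Measurable.tsum fun i => hm.comp (by fun_prop)
  rw [lintegral_eq_zero_iff h8] at h1
  filter_upwards [h1] with c hc i j h7
  have h8 := ENNReal.tsum_eq_zero.1 (ENNReal.tsum_eq_zero.1 hc i) j
  have h9 : (c i, omitAt i c) ∈ D j := h7
  simp [h9] at h8

/-- Almost surely no offer takes a given value. -/
lemma ae_offer_ne_const (ν : Measure M) [IsProbabilityMeasure ν] (hd : 1 ≤ d)
    (hh : Measurable h) (a : ℝ) : ∀ᵐ c ∂pointLaw ν, ∀ i, offer d h (c i) ≠ a := by
  have hD : MeasurableSet {q | offer d h q = a} := measurable_offer hh (measurableSet_singleton a)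
  have hm : Measurable fun x : (ℝ × M) × (ℕ → ℝ × M) =>
      {q | offer d h q = a}.indicator (1 : ℝ × M → ENNReal) x.1 :=
    (measurable_one.indicator hD).comp measurable_fst
  have h1 := mecke ν hm
  simp only [lintegral_const, measure_univ, mul_one] at h1
  rw [lintegral_indicator_one hD, Measure.prod_apply_symm hD] at h1
  have h2 : ∀ m, (volume.restrict (Ioi (0 : ℝ))) ((fun s => (s, m)) ⁻¹' {q | offer d h q = a}) = 0 := by
    intro m
    rw [← volume_rpow_eq hd (a + h m)]
    congr 1
    ext s
    simp [offer, sub_eq_iff_eq_add]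
  simp only [h2, lintegral_zero] at h1
  have h3 : Measurable fun c : ℕ → ℝ × M =>
      ∑' i, {q | offer d h q = a}.indicator (1 : ℝ × M → ENNReal) (c i) :=
    Measurable.tsum fun i => (measurable_one.indicator hD).comp (measurable_pi_apply i)
  rw [lintegral_eq_zero_iff h3] at h1
  filter_upwards [h1] with c hc i h7
  have h8 := ENNReal.tsum_eq_zero.1 hc i
  have h9 : c i ∈ {q | offer d h q = a} := h7
  simp [h9] at h8

end Bellman

lemma volume_rpow_le {d : ℝ} (hd : 1 ≤ d) (t : ℝ) :
    (volume.restrict (Ioi 0)) {s : ℝ | s ^ (1 / d) ≤ t} = ENNReal.ofReal (max 0 t ^ d) := by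
  rw [← volume_rpow_lt hd]
  refine measure_congr ?_
  have h1 : ∀ᵐ s ∂(volume.restrict (Ioi (0 : ℝ))), s ^ (1 / d) ≠ t := by
    rw [ae_iff]; simpa using volume_rpow_eq hd t
  filter_upwards [h1] with s hs
  exact propext ⟨fun h => lt_of_le_of_ne h hs, fun h => le_of_lt h⟩

/-! ### Expected number of optimal offers -/

section Optimal

variable {M : Type*} [MeasurableSpace M] {d θ : ℝ} {h h' : M → ℝ}

/-- The points with optimal offers, weighted by their marks. -/
lemma lintegral_tsum_optimal (ν : Measure M) [IsProbabilityMeasure ν] (hd : 1 ≤ d)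
    (hh : Measurable h) {w : M → ENNReal} (hw : Measurable w) {K : ℝ → ENNReal}
    (hK : Measurable K) :
    ∫⁻ c, ∑' i, (if (c i).1 ^ (1 / d) ≤ θ ∧ offer d h (c i) = bellman d θ h c then
        w (c i).2 * K (bellman d θ h c) else 0) ∂pointLaw ν =
      ∫⁻ q, ∫⁻ c, (if q.1 ^ (1 / d) ≤ θ ∧ offer d h q ≤ bellman d θ h c then
        w q.2 * K (offer d h q) else 0) ∂pointLaw ν ∂((volume.restrict (Ioi 0)).prod ν) := by
  have hz := measurable_offer (d := d) hh
  have hb := measurable_bellman (d := d) (θ := θ) hh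
  have hm : Measurable fun x : (ℝ × M) × (ℕ → ℝ × M) =>
      if x.1.1 ^ (1 / d) ≤ θ ∧ offer d h x.1 ≤ bellman d θ h x.2 then
        w x.1.2 * K (offer d h x.1) else 0 := by
    refine Measurable.ite ?_ (by fun_prop) measurable_const
    have h1 : Measurable fun x : (ℝ × M) × (ℕ → ℝ × M) => x.1.1 ^ (1 / d) := by fun_prop
    exact (h1 measurableSet_Iic).inter
      (measurableSet_le (hz.comp measurable_fst) (hb.comp measurable_snd))
  rw [← mecke ν hm]
  refine lintegral_congr_ae ?_
  filter_upwards [ae_goodPoints ν] with c hc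
  refine tsum_congr fun i => ?_
  by_cases hi : (c i).1 ^ (1 / d) ≤ θ
  · have h1 := bellman_eq_min_omitAt (h := h) hd hc hi
    change _ = min (offer d h (c i)) _ at h1
    -- Optimality is rephrased through the point and the configuration without it, which is the form
    -- that the Mecke formula accepts.
    have h2 : offer d h (c i) = bellman d θ h c ↔
        offer d h (c i) ≤ bellman d θ h (omitAt i c) := by
      rw [h1, eq_comm, min_eq_left_iff]
    simp only [hi, h2, true_and]
    split_ifs with h3
    · rw [h2.2 h3]
    · rfl
  · simp only [hi, false_and, if_false]

/-- Almost surely exactly one offer is optimal if the value is less than `θ / 2`, and none is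
otherwise. -/
lemma ae_tsum_optimal (ν : Measure M) [IsProbabilityMeasure ν] (hd : 1 ≤ d)
    (hh : Measurable h) (K : ℝ → ENNReal) :
    ∀ᵐ c ∂pointLaw ν, ∑' i, (if (c i).1 ^ (1 / d) ≤ θ ∧ offer d h (c i) = bellman d θ h c then
        K (bellman d θ h c) else 0) =
      if bellman d θ h c < θ / 2 then K (bellman d θ h c) else 0 := by
  filter_upwards [ae_goodPoints ν, ae_offer_ne ν hd hh, ae_offer_ne_const ν hd hh (θ / 2)]
    with c hc h1 h2
  split_ifs with h3
  · rcases (isLeast_bellman (θ := θ) hd hc h).1 with h4 | ⟨i, hi, h4⟩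
    · exact absurd h4 h3.ne
    · rw [tsum_eq_single i, if_pos ⟨hi, h4.symm⟩]
      intro j hj
      rw [if_neg]
      rintro ⟨-, h5⟩
      have h6 : offer d h (c i) = offer d h (c j) := h4.symm.trans h5.symm
      rcases lt_or_gt_of_ne hj with h7 | h7
      · exact h1 i j (by rw [h6]; simp [omitAt, h7])
      · have h8 : ¬ j - 1 < i := by omega
        have h9 : j - 1 + 1 = j := by omega
        exact h1 i (j - 1) (by rw [h6]; simp [omitAt, h8, h9])
  · refine ENNReal.tsum_eq_zero.2 fun i => ?_
    rw [if_neg]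
    rintro ⟨-, h5⟩
    exact h2 i (h5.trans (le_antisymm (bellman_le_half hd hc) (not_lt.1 h3)))

/-- Uniqueness of the optimal offer turns the expected sum over optimal points into an expectation
over the value of the root. With `K = 1` it gives a probability; with general `K` it normalizes the
law of the offer in `lintegral_optimal_le`. -/
lemma lintegral_optimal (ν : Measure M) [IsProbabilityMeasure ν] (hd : 1 ≤ d)
    (hh : Measurable h) {K : ℝ → ENNReal} (hK : Measurable K) :
    ∫⁻ q, ∫⁻ c, (if q.1 ^ (1 / d) ≤ θ ∧ offer d h q ≤ bellman d θ h c then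
        K (offer d h q) else 0) ∂pointLaw ν ∂((volume.restrict (Ioi 0)).prod ν) =
      ∫⁻ c, (if bellman d θ h c < θ / 2 then K (bellman d θ h c) else 0) ∂pointLaw ν := by
  have h1 := lintegral_tsum_optimal (θ := θ) ν hd hh (w := fun _ => 1) measurable_const hK
  simp only [one_mul] at h1
  rw [← h1]
  exact lintegral_congr_ae (ae_tsum_optimal ν hd hh K)

/-- The probability that the root has a value less than `θ / 2`. -/
lemma pointLaw_bellman_lt (ν : Measure M) [IsProbabilityMeasure ν] (hd : 1 ≤ d)
    (hh : Measurable h) (hle : ∀ᵐ m ∂ν, h m ≤ θ / 2) :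
    pointLaw ν {c | bellman d θ h c < θ / 2} =
      ∫⁻ m, ∫⁻ c, ENNReal.ofReal (max 0 (h m + bellman d θ h c) ^ d) ∂pointLaw ν ∂ν := by
  have hz := measurable_offer (d := d) hh
  have hb := measurable_bellman (d := d) (θ := θ) hh
  have h1 := lintegral_optimal (θ := θ) ν hd hh (K := fun _ => 1) measurable_const
  have h2 : ∫⁻ c, (if bellman d θ h c < θ / 2 then (1 : ENNReal) else 0) ∂pointLaw ν =
      pointLaw ν {c | bellman d θ h c < θ / 2} := by
    rw [← lintegral_indicator_one (measurableSet_lt hb measurable_const)]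
    rfl
  rw [← h2, ← h1]
  let D : Set ((ℝ × M) × (ℕ → ℝ × M)) :=
    {x | x.1.1 ^ (1 / d) ≤ θ ∧ offer d h x.1 ≤ bellman d θ h x.2}
  have hD : MeasurableSet D := by
    have h1 : Measurable fun x : (ℝ × M) × (ℕ → ℝ × M) => x.1.1 ^ (1 / d) := by fun_prop
    exact (h1 measurableSet_Iic).inter
      (measurableSet_le (hz.comp measurable_fst) (hb.comp measurable_snd))
  have hind : Measurable (D.indicator (1 : _ × (ℕ → ℝ × M) → ENNReal)) :=
    measurable_one.indicator hD
  have h3 : ∀ q : ℝ × M, ∀ c, (if q.1 ^ (1 / d) ≤ θ ∧ offer d h q ≤ bellman d θ h c then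
      (1 : ENNReal) else 0) = D.indicator 1 (q, c) := fun q c => by
    by_cases h4 : (q, c) ∈ D
    · rw [indicator_of_mem h4]; exact if_pos h4
    · rw [indicator_of_notMem h4]; exact if_neg h4
  simp only [h3]
  rw [lintegral_prod_symm _ hind.lintegral_prod_right'.aemeasurable]
  refine lintegral_congr_ae ?_
  filter_upwards [hle] with m hm
  have h4 : Measurable fun x : ℝ × (ℕ → ℝ × M) =>
      D.indicator (1 : _ × (ℕ → ℝ × M) → ENNReal) ((x.1, m), x.2) := hind.comp (by fun_prop)
  rw [lintegral_lintegral_swap h4.aemeasurable]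
  refine lintegral_congr_ae ?_
  filter_upwards [ae_goodPoints ν] with c hc
  rw [← volume_rpow_le hd, ← lintegral_indicator_one
    (measurableSet_le (by fun_prop) measurable_const)]
  refine lintegral_congr fun s => ?_
  -- As both `h m` and the value are at most `θ / 2`, an optimal offer comes from a length at most
  -- `θ`, so the cutoff imposes nothing.
  have h5 := bellman_le_half (θ := θ) (h := h) hd hc
  have h6 : ((s, m), c) ∈ D ↔ s ∈ {s : ℝ | s ^ (1 / d) ≤ h m + bellman d θ h c} := by
    simp only [D, offer, Set.mem_ofPred_eq]
    constructor
    · rintro ⟨-, h7⟩; linarith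
    · intro h7; constructor <;> linarith
  by_cases h7 : ((s, m), c) ∈ D
  · rw [indicator_of_mem h7, indicator_of_mem (h6.1 h7)]; rfl
  · rw [indicator_of_notMem h7, indicator_of_notMem (h6.not.1 h7)]

end Optimal

lemma measurable_bounds (d θ : ℝ) (n : ℕ) :
    Measurable (lower d θ n) ∧ Measurable (upper d θ n) := by
  induction n with
  | zero => exact ⟨measurable_const, measurable_const⟩
  | succ n ih =>
    exact ⟨(measurable_bellman ih.2).comp measurable_rootPoints,
      (measurable_bellman ih.1).comp measurable_rootPoints⟩

lemma measurable_lowerLim (d θ : ℝ) : Measurable (lowerLim d θ) :=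
  Measurable.iSup fun n => (measurable_bounds d θ n).1

lemma measurable_upperLim (d θ : ℝ) : Measurable (upperLim d θ) :=
  Measurable.iInf fun n => (measurable_bounds d θ n).2

/-! ### Equality of the two limits -/

section Limit

variable {d θ : ℝ}

/-- The law of the value of the root when the children have values given by `h`. -/
lemma treeLaw_bellman {h : Tree → ℝ} (hh : Measurable h) {S : Set ℝ} (hS : MeasurableSet S) :
    treeLaw {T | bellman d θ h (rootPoints T) ∈ S} =
      pointLaw treeLaw {c | bellman d θ h c ∈ S} := by
  rw [← map_rootPoints_treeLaw]
  exact (Measure.map_apply measurable_rootPoints (measurable_bellman hh hS)).symm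

lemma ae_upperLim_le (hd : 1 ≤ d) (hθ : 0 ≤ θ) : ∀ᵐ T ∂treeLaw, upperLim d θ T ≤ θ / 2 := by
  filter_upwards [ae_goodTree] with T hT
  exact upperLim_le_half hd hθ hT

lemma ae_lowerLim_le (hd : 1 ≤ d) (hθ : 0 ≤ θ) : ∀ᵐ T ∂treeLaw, lowerLim d θ T ≤ θ / 2 := by
  filter_upwards [ae_goodTree] with T hT
  exact (lowerLim_le_upperLim hd hθ hT).trans (upperLim_le_half hd hθ hT)

lemma treeLaw_upperLim (hd : 1 ≤ d) (hθ : 0 ≤ θ) {S : Set ℝ} (hS : MeasurableSet S) :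
    treeLaw {T | upperLim d θ T ∈ S} =
      pointLaw treeLaw {c | bellman d θ (lowerLim d θ) c ∈ S} := by
  rw [← treeLaw_bellman (measurable_lowerLim d θ) hS]
  refine measure_congr ?_
  filter_upwards [ae_goodTree] with T hT
  refine propext ?_
  show upperLim d θ T ∈ S ↔ bellman d θ (lowerLim d θ) (rootPoints T) ∈ S
  rw [upperLim_eq hd hθ hT]

lemma treeLaw_lowerLim (hd : 1 ≤ d) (hθ : 0 ≤ θ) {S : Set ℝ} (hS : MeasurableSet S) :
    treeLaw {T | lowerLim d θ T ∈ S} =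
      pointLaw treeLaw {c | bellman d θ (upperLim d θ) c ∈ S} := by
  rw [← treeLaw_bellman (measurable_upperLim d θ) hS]
  refine measure_congr ?_
  filter_upwards [ae_goodTree] with T hT
  refine propext ?_
  show lowerLim d θ T ∈ S ↔ bellman d θ (upperLim d θ) (rootPoints T) ∈ S
  rw [lowerLim_eq hd hθ hT]

lemma lintegral_bellman_rootPoints {h : Tree → ℝ} (hh : Measurable h) {K : ℝ → ENNReal}
    (hK : Measurable K) :
    ∫⁻ c, K (bellman d θ h c) ∂pointLaw treeLaw =
      ∫⁻ T, K (bellman d θ h (rootPoints T)) ∂treeLaw := by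
  rw [← map_rootPoints_treeLaw]
  exact lintegral_map (hK.comp (measurable_bellman hh)) measurable_rootPoints

/-- The upper and the lower bound reach `θ / 2` with the same probability. -/
lemma treeLaw_half_le_eq (hd : 1 ≤ d) (hθ : 0 ≤ θ) :
    treeLaw {T | upperLim d θ T < θ / 2} = treeLaw {T | lowerLim d θ T < θ / 2} := by
  have hK : ∀ a : ℝ, Measurable fun x : ℝ => ENNReal.ofReal (max 0 (a + x) ^ d) := fun a => by
    fun_prop
  have hU := measurable_upperLim d θ
  have hL := measurable_lowerLim d θ
  have h1 := treeLaw_upperLim hd hθ (measurableSet_Iio (a := θ / 2))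
  have h2 := treeLaw_lowerLim hd hθ (measurableSet_Iio (a := θ / 2))
  simp only [mem_Iio] at h1 h2
  rw [h1, h2, pointLaw_bellman_lt _ hd hL (ae_lowerLim_le hd hθ),
    pointLaw_bellman_lt _ hd hU (ae_upperLim_le hd hθ)]
  simp only [fun m => lintegral_bellman_rootPoints (d := d) (θ := θ) hL (hK (lowerLim d θ m)),
    fun m => lintegral_bellman_rootPoints (d := d) (θ := θ) hU (hK (upperLim d θ m))]
  -- One side integrates `(L + U')₊^d` and the other `(U + L')₊^d` over two independent trees;
  -- exchanging the trees identifies them.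
  rw [lintegral_lintegral_swap]
  · have h3 : ∀ m, ∫⁻ T, ENNReal.ofReal (max 0 (upperLim d θ m +
        bellman d θ (upperLim d θ) (rootPoints T)) ^ d) ∂treeLaw =
        ∫⁻ T, ENNReal.ofReal (max 0 (upperLim d θ m + lowerLim d θ T) ^ d) ∂treeLaw := by
      intro m
      refine lintegral_congr_ae ?_
      filter_upwards [ae_goodTree] with T hT
      rw [lowerLim_eq hd hθ hT]
    simp only [h3]
    refine lintegral_congr_ae ?_
    filter_upwards [ae_goodTree] with T hT
    rw [upperLim_eq hd hθ hT]
    simp only [add_comm]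
  · refine Measurable.aemeasurable ?_
    have h4 : Measurable fun x : Tree × Tree =>
        bellman d θ (lowerLim d θ) (rootPoints x.2) :=
      ((measurable_bellman hL).comp measurable_rootPoints).comp measurable_snd
    simp only [Function.uncurry_def]
    fun_prop

/-- The upper and the lower bounds have the same limit, almost surely. -/
theorem ae_lowerLim_eq_upperLim (hd : 1 ≤ d) (hθ : 0 ≤ θ) :
    ∀ᵐ T ∂treeLaw, lowerLim d θ T = upperLim d θ T := by
  have hd0 : 0 < d := by linarith
  have hU := measurable_upperLim d θ
  have hL := measurable_lowerLim d θ
  have hP : treeLaw {T | θ / 2 ≤ upperLim d θ T} = treeLaw {T | θ / 2 ≤ lowerLim d θ T} := by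
    have h1 : {T | θ / 2 ≤ upperLim d θ T} = {T | upperLim d θ T < θ / 2}ᶜ := by
      ext; simp
    have h2 : {T | θ / 2 ≤ lowerLim d θ T} = {T | lowerLim d θ T < θ / 2}ᶜ := by
      ext; simp
    rw [h1, h2, prob_compl_eq_one_sub (measurableSet_lt hU measurable_const),
      prob_compl_eq_one_sub (measurableSet_lt hL measurable_const), treeLaw_half_le_eq hd hθ]
  have h1 := treeLaw_upperLim hd hθ (measurableSet_Ici (a := θ / 2))
  have h2 := treeLaw_lowerLim hd hθ (measurableSet_Ici (a := θ / 2))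
  simp only [mem_Ici] at h1 h2
  -- The tail formula at the single point `θ / 2` converts equal probabilities of the value `θ / 2`
  -- into equal moments of `θ / 2 + L` and `θ / 2 + U`.
  obtain ⟨h3, h4⟩ := pointLaw_le_bellman treeLaw hd hL (ae_lowerLim_le hd hθ) (le_refl (θ / 2))
  obtain ⟨h5, h6⟩ := pointLaw_le_bellman treeLaw hd hU (ae_upperLim_le hd hθ) (le_refl (θ / 2))
  rw [h1, h2, h4, h6, ENNReal.ofReal_eq_ofReal_iff (Real.exp_nonneg _) (Real.exp_nonneg _),
    Real.exp_eq_exp, neg_inj, ENNReal.toReal_eq_toReal_iff' h3 h5] at hP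
  have hle : (fun T => ENNReal.ofReal (max 0 (θ / 2 + lowerLim d θ T) ^ d)) ≤ᵐ[treeLaw]
      fun T => ENNReal.ofReal (max 0 (θ / 2 + upperLim d θ T) ^ d) := by
    filter_upwards [ae_goodTree] with T hT
    refine ENNReal.ofReal_le_ofReal (Real.rpow_le_rpow (le_max_left _ _) ?_ hd0.le)
    exact max_le_max le_rfl (add_le_add_right (lowerLim_le_upperLim hd hθ hT) _)
  -- Ordered functions with the same finite integral agree almost everywhere. The power is then
  -- undone by injectivity on the nonnegative reals, where both sums lie.
  have heq := ae_eq_of_ae_le_of_lintegral_le hle h3 (by fun_prop) hP.ge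
  filter_upwards [heq, ae_goodTree] with T h7 hT
  have h8 := neg_half_le_lowerLim hd hθ hT
  have h9 := lowerLim_le_upperLim hd hθ hT
  rw [max_eq_right (by linarith), max_eq_right (by linarith),
    ENNReal.ofReal_eq_ofReal_iff (Real.rpow_nonneg (by linarith) _)
      (Real.rpow_nonneg (by linarith) _)] at h7
  have := Real.rpow_left_injOn hd0.ne' (show (0 : ℝ) ≤ θ / 2 + lowerLim d θ T by linarith)
    (show (0 : ℝ) ≤ θ / 2 + upperLim d θ T by linarith) h7
  linarith

theorem ae_regular (hd : 1 ≤ d) (hθ : 0 ≤ θ) : ∀ᵐ T ∂treeLaw, Regular d θ T :=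
  ae_goodTree.and <| ae_all_iff.2 fun v =>
    (measurePreserving_subtreeAt v).quasiMeasurePreserving.ae (ae_lowerLim_eq_upperLim hd hθ)

end Limit

/-! ### The fixed point of `V_θ` -/

section FixedPoint

variable {d θ : ℝ} {F G : ℝ → ℝ}

lemma sub_mem_Icc {x l : ℝ} (hx : x ∈ Icc (-(θ / 2)) (θ / 2)) (hl : l ∈ Icc 0 (θ / 2 + x)) :
    l - x ∈ Icc (-(θ / 2)) (θ / 2) :=
  ⟨by linarith [hx.2, hl.1], by linarith [hl.2]⟩

lemma intervalIntegrable_opV (hd : 1 ≤ d) (hF : IntegrableOn F (Icc (-(θ / 2)) (θ / 2)))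
    {x : ℝ} (hx : x ∈ Icc (-(θ / 2)) (θ / 2)) :
    IntervalIntegrable (fun l => l ^ (d - 1) * F (l - x)) volume 0 (θ / 2 + x) := by
  have h1 : IntervalIntegrable F volume (-x) (θ / 2) := by
    rw [intervalIntegrable_iff_integrableOn_Icc_of_le (by linarith [hx.1])]
    exact hF.mono_set (Icc_subset_Icc (by linarith [hx.2]) le_rfl)
  have h2 := h1.comp_sub_right x
  rw [neg_add_cancel] at h2
  exact h2.continuousOn_mul
    (Real.continuous_rpow_const (by linarith)).continuousOn

lemma opV_anti (hd : 1 ≤ d) (hF : IntegrableOn F (Icc (-(θ / 2)) (θ / 2)))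
    (hG : IntegrableOn G (Icc (-(θ / 2)) (θ / 2)))
    (h : ∀ y ∈ Icc (-(θ / 2)) (θ / 2), F y ≤ G y) {x : ℝ} (hx : x ∈ Icc (-(θ / 2)) (θ / 2)) :
    opV d θ G x ≤ opV d θ F x := by
  refine Real.exp_le_exp.2 (neg_le_neg (mul_le_mul_of_nonneg_left ?_ (by linarith)))
  refine intervalIntegral.integral_mono_on (by linarith [hx.1]) (intervalIntegrable_opV hd hF hx)
    (intervalIntegrable_opV hd hG hx) fun l hl => ?_
  exact mul_le_mul_of_nonneg_left (h _ (sub_mem_Icc hx hl)) (Real.rpow_nonneg hl.1 _)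

/-- The tail probabilities of `h`. -/
noncomputable def tail {M : Type*} [MeasurableSpace M] (ν : Measure M) (h : M → ℝ) (y : ℝ) : ℝ :=
  (ν {m | y ≤ h m}).toReal

lemma tail_congr_ae {M : Type*} [MeasurableSpace M] {ν : Measure M} {h h' : M → ℝ}
    (hhh : h =ᵐ[ν] h') : tail ν h = tail ν h' := by
  funext y
  refine congrArg _ (measure_congr ?_)
  filter_upwards [hhh] with m hm
  exact propext (by show y ≤ h m ↔ y ≤ h' m; rw [hm])

variable {M : Type*} [MeasurableSpace M] {ν : Measure M} [IsProbabilityMeasure ν] {h : M → ℝ}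

lemma antitone_tail : Antitone (tail ν h) := fun _ _ hyz =>
  ENNReal.toReal_mono (measure_ne_top _ _) (measure_mono fun _ hm => le_trans hyz hm)

lemma integrableOn_tail : IntegrableOn (tail ν h) (Icc (-(θ / 2)) (θ / 2)) :=
  (antitone_tail.antitoneOn _).integrableOn_isCompact isCompact_Icc

/-- The layer-cake formula for the `d`-th moment. The integral stops at `θ / 2 + x` because `x + h`
almost surely does not exceed it. -/
lemma toReal_lintegral_rpow (hd : 1 ≤ d) (hh : Measurable h) (hle : ∀ᵐ m ∂ν, h m ≤ θ / 2) {x : ℝ}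
    (hx : x ∈ Icc (-(θ / 2)) (θ / 2)) :
    (∫⁻ m, ENNReal.ofReal (max 0 (x + h m) ^ d) ∂ν).toReal =
      d * ∫ l in (0 : ℝ)..(θ / 2 + x), l ^ (d - 1) * tail ν h (l - x) := by
  have hL : 0 ≤ θ / 2 + x := by linarith [hx.1]
  have h0 : ∫⁻ m, ENNReal.ofReal (max 0 (x + h m) ^ d) ∂ν = ENNReal.ofReal d *
      ∫⁻ t in Ioi 0, ν {a | t ≤ max 0 (x + h a)} * ENNReal.ofReal (t ^ (d - 1)) :=
    lintegral_rpow_eq_lintegral_meas_le_mul ν (Eventually.of_forall fun m => le_max_left _ _)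
      (by fun_prop) (by linarith)
  rw [h0, ENNReal.toReal_mul, ENNReal.toReal_ofReal (by linarith),
    intervalIntegral.integral_of_le hL, integral_eq_lintegral_of_nonneg_ae]
  · congr 2
    rw [← Ioc_union_Ioi_eq_Ioi hL, lintegral_union measurableSet_Ioi
      (Set.disjoint_left.2 fun t h1 h2 => not_lt.2 h1.2 h2)]
    have h1 : ∫⁻ t in Ioi (θ / 2 + x),
        ν {a | t ≤ max 0 (x + h a)} * ENNReal.ofReal (t ^ (d - 1)) = 0 := by
      rw [lintegral_eq_zero_of_ae_eq_zero]
      filter_upwards [ae_restrict_mem measurableSet_Ioi] with t ht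
      have h2 : ν {a | t ≤ max 0 (x + h a)} = 0 := by
        refine measure_mono_null ?_ (ae_iff.1 hle)
        intro a ha hle
        have h3 : max 0 (x + h a) ≤ θ / 2 + x := max_le hL (by linarith)
        exact absurd (ha.trans h3) (not_le.2 ht)
      show ν _ * _ = 0
      rw [h2, zero_mul]
    rw [h1, add_zero]
    refine setLIntegral_congr_fun measurableSet_Ioc fun t ht => ?_
    have h2 : {a | t ≤ max 0 (x + h a)} = {a | t - x ≤ h a} := by
      ext a
      simp only [Set.mem_ofPred_eq, le_max_iff, not_le.2 ht.1, false_or]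
      exact sub_le_iff_le_add'.symm
    simp only [h2, tail]
    rw [mul_comm, ENNReal.ofReal_mul (Real.rpow_nonneg ht.1.le _),
      ENNReal.ofReal_toReal (measure_ne_top _ _)]
  · filter_upwards [ae_restrict_mem measurableSet_Ioc] with t ht
    exact mul_nonneg (Real.rpow_nonneg ht.1.le _) ENNReal.toReal_nonneg
  · have := intervalIntegrable_opV hd (integrableOn_tail (ν := ν) (h := h)) hx
    rw [intervalIntegrable_iff_integrableOn_Ioc_of_le hL] at this
    exact this.aestronglyMeasurable

/-- The probabilistic meaning of `V_θ`: one round of the recursion, seen on tail functions. -/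
lemma tail_bellman (hd : 1 ≤ d) (hh : Measurable h) (hle : ∀ᵐ m ∂ν, h m ≤ θ / 2) {x : ℝ}
    (hx : x ∈ Icc (-(θ / 2)) (θ / 2)) :
    tail (pointLaw ν) (bellman d θ h) x = opV d θ (tail ν h) x := by
  rw [tail, (pointLaw_le_bellman ν hd hh hle hx.2).2, ENNReal.toReal_ofReal (Real.exp_nonneg _),
    toReal_lintegral_rpow hd hh hle hx]
  rfl

lemma tail_bellman_rootPoints (hd : 1 ≤ d) {h : Tree → ℝ} (hh : Measurable h)
    (hle : ∀ᵐ m ∂treeLaw, h m ≤ θ / 2) {x : ℝ} (hx : x ∈ Icc (-(θ / 2)) (θ / 2)) :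
    tail treeLaw (fun T => bellman d θ h (rootPoints T)) x = opV d θ (tail treeLaw h) x := by
  rw [← tail_bellman hd hh hle hx, tail, tail]
  exact congrArg _ (treeLaw_bellman hh measurableSet_Ici)

lemma IsFixedPointV.pos (hG : IsFixedPointV d θ G) {x : ℝ} (hx : x ∈ Icc (-(θ / 2)) (θ / 2)) :
    0 < G x := by
  rw [← hG.2 hx]; exact Real.exp_pos _

lemma IsFixedPointV.le_one (hd : 1 ≤ d) (hG : IsFixedPointV d θ G) {x : ℝ}
    (hx : x ∈ Icc (-(θ / 2)) (θ / 2)) : G x ≤ 1 := by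
  have h1 := opV_anti hd (F := fun _ => 0) integrableOn_zero hG.1 (fun y hy => (hG.pos hy).le) hx
  rw [hG.2 hx] at h1
  refine h1.trans_eq ?_
  simp [opV]

lemma IsFixedPointV.apply_left (hG : IsFixedPointV d θ G) (hθ : 0 ≤ θ) : G (-(θ / 2)) = 1 := by
  rw [← hG.2 (left_mem_Icc.2 (by linarith))]
  simp [opV]

/-- The enclosure holds for the constant starts, since `0 < G ≤ 1`, and each application of the
order-reversing `V_θ` exchanges the two bounds. `G` need not be a tail function. -/
lemma IsFixedPointV.mem_Icc (hd : 1 ≤ d) (hθ : 0 ≤ θ) (hG : IsFixedPointV d θ G) (n : ℕ) :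
    ∀ x ∈ Icc (-(θ / 2)) (θ / 2),
      tail treeLaw (lower d θ n) x ≤ G x ∧ G x ≤ tail treeLaw (upper d θ n) x := by
  have hU : ∀ n, ∀ᵐ T ∂treeLaw, upper d θ n T ≤ θ / 2 := fun n => by
    filter_upwards [ae_goodTree] with T hT using upper_le_half hd n hT
  have hL : ∀ n, ∀ᵐ T ∂treeLaw, lower d θ n T ≤ θ / 2 := fun n => by
    filter_upwards [ae_goodTree] with T hT
    exact (lower_le_upper hd hθ n hT).trans (upper_le_half hd n hT)
  induction n with
  | zero =>
    intro x hx
    constructor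
    -- The tail of the constant `-θ/2` equals `1` at the left endpoint, so `G = 1` there is needed.
    · rcases eq_or_lt_of_le hx.1 with rfl | h1
      · rw [hG.apply_left hθ]
        exact ENNReal.toReal_mono ENNReal.one_ne_top prob_le_one
      · have h2 : tail treeLaw (lower d θ 0) x = 0 := by
          have : {T : Tree | x ≤ lower d θ 0 T} = ∅ :=
            eq_empty_of_forall_notMem fun T hT => absurd (show x ≤ -(θ / 2) from hT) (not_le.2 h1)
          simp [tail, this]
        rw [h2]; exact (hG.pos hx).le
    · have h2 : tail treeLaw (upper d θ 0) x = 1 := by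
        have : {T : Tree | x ≤ upper d θ 0 T} = univ := eq_univ_of_forall fun T => hx.2
        simp [tail, this]
      rw [h2]; exact hG.le_one hd hx
  | succ n ih =>
    intro x hx
    have h1 := tail_bellman_rootPoints hd (measurable_bounds d θ n).2 (hU n) hx
    have h2 := tail_bellman_rootPoints hd (measurable_bounds d θ n).1 (hL n) hx
    constructor
    · refine h1.trans_le ?_
      rw [← hG.2 hx]
      exact opV_anti hd hG.1 integrableOn_tail (fun y hy => (ih y hy).2) hx
    · refine le_of_le_of_eq ?_ h2.symm
      rw [← hG.2 hx]
      exact opV_anti hd integrableOn_tail hG.1 (fun y hy => (ih y hy).1) hx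

lemma isFixedPointV_tail (hd : 1 ≤ d) (hθ : 0 ≤ θ) :
    IsFixedPointV d θ (tail treeLaw (upperLim d θ)) := by
  refine ⟨integrableOn_tail, fun x hx => ?_⟩
  rw [← tail_bellman_rootPoints hd (measurable_upperLim d θ) (ae_upperLim_le hd hθ) hx]
  refine congrFun (tail_congr_ae ?_) x
  filter_upwards [ae_regular hd hθ] with T hT
  exact (hT.upperLim_eq_bellman hd hθ).symm

/-- The value of a vertex of the PWIT has a distribution given by the only fixed point. -/
theorem IsFixedPointV.eqOn_tail (hd : 1 ≤ d) (hθ : 0 ≤ θ) (hG : IsFixedPointV d θ G) :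
    EqOn G (tail treeLaw (upperLim d θ)) (Icc (-(θ / 2)) (θ / 2)) := by
  have hle : ∀ x ∈ Icc (-(θ / 2)) (θ / 2), G x ≤ tail treeLaw (upperLim d θ) x := by
    intro x hx
    -- The bounds decrease only on good trees; quantifying over `k ≤ n` makes the events decrease
    -- everywhere, as continuity from above requires.
    have h1 : Antitone fun n => {T : Tree | ∀ k ≤ n, x ≤ upper d θ k T} :=
      fun m n hmn T hT k hk => hT k (hk.trans hmn)
    have h2 : ∀ n, MeasurableSet {T : Tree | ∀ k ≤ n, x ≤ upper d θ k T} := by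
      intro n
      simp only [ofPred_forall]
      exact MeasurableSet.iInter fun k => MeasurableSet.iInter fun _ =>
        measurableSet_le measurable_const (measurable_bounds d θ k).2
    have h3 := tendsto_measure_iInter_atTop (μ := treeLaw)
      (fun n => (h2 n).nullMeasurableSet) h1 ⟨0, measure_ne_top _ _⟩
    have h4 : treeLaw (⋂ n, {T : Tree | ∀ k ≤ n, x ≤ upper d θ k T}) =
        treeLaw {T | x ≤ upperLim d θ T} := by
      refine measure_congr ?_
      filter_upwards [ae_goodTree] with T hT
      refine propext ?_
      show T ∈ (⋂ n, {T : Tree | ∀ k ≤ n, x ≤ upper d θ k T}) ↔ x ≤ upperLim d θ T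
      rw [mem_iInter]
      constructor
      · exact fun h => ge_of_tendsto' (tendsto_upper hd hθ hT) fun n => h n n le_rfl
      · exact fun h n k _ => h.trans (upperLim_le_upper hd hθ hT k)
    rw [h4] at h3
    refine ge_of_tendsto' ((ENNReal.tendsto_toReal (measure_ne_top _ _)).comp h3) fun n => ?_
    refine ((hG.mem_Icc hd hθ n x hx).2).trans_eq ?_
    refine congrArg _ (measure_congr ?_)
    filter_upwards [ae_goodTree] with T hT
    exact propext ⟨fun h k hk => h.trans (upper_antitone hd hθ hT hk), fun h => h n le_rfl⟩
  intro x hx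
  -- Both functions are fixed by `V_θ`, which reverses the inequality just proved.
  refine le_antisymm (hle x hx) ?_
  rw [← hG.2 hx, ← (isFixedPointV_tail hd hθ).2 hx]
  exact opV_anti hd hG.1 integrableOn_tail hle hx

end FixedPoint

/-! ### Counting near-optimal play -/

section Density

/-- The density of `d`-th powers. -/
noncomputable def powDensity (d t : ℝ) : ENNReal :=
  if 0 < t then ENNReal.ofReal (d * t ^ (d - 1)) else 0

lemma measurable_powDensity (d : ℝ) : Measurable (powDensity d) := by
  unfold powDensity
  exact Measurable.ite measurableSet_Ioi (by fun_prop) measurable_const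

/-- Here `1 ≤ d` matters, not merely `0 < d`. Both estimates for a move of Alice rest on it: the
effect of the bias in `setLIntegral_powDensity_le` and the count of suboptimal offers in
`lintegral_excess_le`. -/
lemma powDensity_mono {d : ℝ} (hd : 1 ≤ d) : Monotone (powDensity d) := by
  intro s t hst
  unfold powDensity
  split_ifs with h1 h2
  · refine ENNReal.ofReal_le_ofReal (mul_le_mul_of_nonneg_left ?_ (by linarith))
    exact Real.rpow_le_rpow h1.le hst (by linarith)
  · exact absurd (h1.trans_le hst) h2
  · exact zero_le
  · exact le_rfl

lemma powDensity_ne_top (d t : ℝ) : powDensity d t ≠ ⊤ := by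
  unfold powDensity; split_ifs <;> simp

lemma lintegral_rpow_inv {d : ℝ} (hd : 1 ≤ d) (ψ : ℝ → ENNReal) :
    ∫⁻ s in Ioi 0, ψ (s ^ (1 / d)) = ∫⁻ t, powDensity d t * ψ t := by
  have hd0 : 0 < d := by linarith
  have himg : (fun t : ℝ => t ^ d) '' Ioi 0 = Ioi 0 := by
    ext s
    constructor
    · rintro ⟨t, ht, rfl⟩; exact Real.rpow_pos_of_pos ht _
    · intro hs
      exact ⟨s ^ (1 / d), Real.rpow_pos_of_pos hs _, by
        show (s ^ (1 / d)) ^ d = s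
        rw [one_div, Real.rpow_inv_rpow (le_of_lt hs) hd0.ne']⟩
  have hinj : InjOn (fun t : ℝ => t ^ d) (Ioi 0) := fun a ha b hb hab =>
    Real.rpow_left_injOn hd0.ne' (mem_Ioi.1 ha).le (mem_Ioi.1 hb).le hab
  have h1 := lintegral_image_eq_lintegral_abs_deriv_mul measurableSet_Ioi
    (fun t ht => (Real.hasDerivAt_rpow_const (p := d) (Or.inl (ne_of_gt ht))).hasDerivWithinAt)
    hinj fun s => ψ (s ^ (1 / d))
  rw [himg] at h1
  rw [h1, ← lintegral_indicator measurableSet_Ioi]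
  refine lintegral_congr fun t => ?_
  by_cases ht : 0 < t
  · rw [indicator_of_mem (mem_Ioi.2 ht), powDensity, if_pos ht, one_div,
      Real.rpow_rpow_inv ht.le hd0.ne', abs_of_nonneg (by positivity)]
  · rw [indicator_of_notMem (by simpa using ht), powDensity, if_neg ht, zero_mul]

variable {M : Type*} [MeasurableSpace M] {d θ : ℝ} {h : M → ℝ}

/-- Integration over marked points in terms of the offers. -/
lemma lintegral_offer (ν : Measure M) [IsProbabilityMeasure ν] (hd : 1 ≤ d) (hh : Measurable h)
    {Φ : ℝ × ℝ × M → ENNReal} (hΦ : Measurable Φ) :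
    ∫⁻ q, Φ (offer d h q, q.1 ^ (1 / d), q.2) ∂((volume.restrict (Ioi 0)).prod ν) =
      ∫⁻ m, ∫⁻ z, powDensity d (z + h m) * Φ (z, z + h m, m) ∂volume ∂ν := by
  have hz := measurable_offer (d := d) hh
  rw [lintegral_prod_symm _ (by fun_prop)]
  refine lintegral_congr fun m => ?_
  refine (lintegral_rpow_inv hd fun t => Φ (t - h m, t, m)).trans ?_
  rw [← lintegral_add_right_eq_self _ (h m)]
  simp only [add_sub_cancel_right]

end Density

/-! ### Expected weight after a single move -/

section Steps

variable {M : Type*} [MeasurableSpace M] {d θ : ℝ} {h : M → ℝ} {w : M → ENNReal} {K : ℝ → ENNReal}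

/-- The expected number of optimal points, weighted by their marks and their offers. -/
lemma lintegral_optimal_eq (ν : Measure M) [IsProbabilityMeasure ν] (hd : 1 ≤ d)
    (hh : Measurable h) (hle : ∀ᵐ m ∂ν, h m ≤ θ / 2) (hw : Measurable w) (hK : Measurable K) :
    ∫⁻ q, ∫⁻ c, (if q.1 ^ (1 / d) ≤ θ ∧ offer d h q ≤ bellman d θ h c then
        w q.2 * K (offer d h q) else 0) ∂pointLaw ν ∂((volume.restrict (Ioi 0)).prod ν) =
      ∫⁻ z, (∫⁻ m, w m * powDensity d (z + h m) ∂ν) *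
        (pointLaw ν {c | z ≤ bellman d θ h c} * K z) := by
  have hb := measurable_bellman (d := d) (θ := θ) hh
  have hk := measurable_powDensity d
  have hp : Measurable fun z => pointLaw ν {c | z ≤ bellman d θ h c} := by
    have : Antitone fun z => pointLaw ν {c | z ≤ bellman d θ h c} :=
      fun a b hab => measure_mono fun c hc => hab.trans hc
    exact this.measurable
  let Φ : ℝ × ℝ × M → ENNReal := fun x => ∫⁻ c, (if x.2.1 ≤ θ ∧ x.1 ≤ bellman d θ h c then
        w x.2.2 * K x.1 else 0) ∂pointLaw ν
  have hΦ : Measurable Φ := by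
    refine Measurable.lintegral_prod_right' (f := fun y : (ℝ × ℝ × M) × (ℕ → ℝ × M) =>
      if y.1.2.1 ≤ θ ∧ y.1.1 ≤ bellman d θ h y.2 then w y.1.2.2 * K y.1.1 else 0) ?_
    refine Measurable.ite ?_ (by fun_prop) measurable_const
    have h1 : Measurable fun y : (ℝ × ℝ × M) × (ℕ → ℝ × M) => y.1.2.1 := by fun_prop
    exact (h1 measurableSet_Iic).inter (measurableSet_le (by fun_prop) (hb.comp measurable_snd))
  refine (lintegral_offer ν hd hh hΦ).trans ?_
  have h1 : ∀ᵐ m ∂ν, ∫⁻ z, powDensity d (z + h m) * Φ (z, z + h m, m) =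
      ∫⁻ z, w m * powDensity d (z + h m) * (pointLaw ν {c | z ≤ bellman d θ h c} * K z) := by
    filter_upwards [hle] with m hm
    refine lintegral_congr fun z => ?_
    have h2 : Φ (z, z + h m, m) = w m * K z * pointLaw ν {c | z ≤ bellman d θ h c} := by
      rw [← lintegral_indicator_one (measurableSet_le measurable_const hb),
        ← lintegral_const_mul _ (measurable_one.indicator (measurableSet_le measurable_const hb))]
      refine lintegral_congr_ae ?_
      filter_upwards [ae_goodPoints ν] with c hc
      have h3 := bellman_le_half (θ := θ) (h := h) hd hc
      by_cases h4 : z ≤ bellman d θ h c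
      · rw [indicator_of_mem (show c ∈ {c | z ≤ bellman d θ h c} from h4)]
        simp only [h4, and_true, Pi.one_apply, mul_one]
        rw [if_pos (by linarith)]
      · rw [indicator_of_notMem (show c ∉ {c | z ≤ bellman d θ h c} from h4)]
        simp only [h4, and_false, if_false, mul_zero]
    rw [h2]; ring
  have h5 : Measurable fun p : M × ℝ =>
      w p.1 * powDensity d (p.2 + h p.1) * (pointLaw ν {c | p.2 ≤ bellman d θ h c} * K p.2) :=
    (Measurable.mul (by fun_prop) (by fun_prop)).mul
      ((hp.comp measurable_snd).mul (hK.comp measurable_snd))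
  rw [lintegral_congr_ae h1, lintegral_lintegral_swap h5.aemeasurable]
  refine lintegral_congr fun z => ?_
  rw [lintegral_mul_const _ (by fun_prop)]

/-- The expected number of points whose offers exceed the value of the root by at most `δ`. -/
lemma lintegral_excess_le (ν : Measure M) [IsProbabilityMeasure ν] (hd : 1 ≤ d)
    (hh : Measurable h) (hw : Measurable w) (hK : Measurable K) (δ : ℝ) :
    ∫⁻ q, ∫⁻ c, (if q.1 ^ (1 / d) ≤ θ ∧ bellman d θ h c < offer d h q ∧
        offer d h q ≤ bellman d θ h c + δ then w q.2 * K (bellman d θ h c) else 0) ∂pointLaw ν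
          ∂((volume.restrict (Ioi 0)).prod ν) ≤
      (∫⁻ m, w m ∂ν) * (powDensity d θ * ENNReal.ofReal δ) *
        ∫⁻ c, K (bellman d θ h c) ∂pointLaw ν := by
  have hb := measurable_bellman (d := d) (θ := θ) hh
  have hk := measurable_powDensity d
  let Ψ : (ℝ × ℝ × M) × (ℕ → ℝ × M) → ENNReal := fun y =>
    if y.1.2.1 ≤ θ ∧ bellman d θ h y.2 < y.1.1 ∧ y.1.1 ≤ bellman d θ h y.2 + δ then
      w y.1.2.2 * K (bellman d θ h y.2) else 0
  have hΨ : Measurable Ψ := by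
    refine Measurable.ite ?_ (by fun_prop) measurable_const
    have h1 : Measurable fun y : (ℝ × ℝ × M) × (ℕ → ℝ × M) => y.1.2.1 := by fun_prop
    exact (h1 measurableSet_Iic).inter
      ((measurableSet_lt (hb.comp measurable_snd) (by fun_prop)).inter
        (measurableSet_le (by fun_prop) ((hb.comp measurable_snd).add_const δ)))
  refine (lintegral_offer ν hd hh (Φ := fun x => ∫⁻ c, Ψ (x, c) ∂pointLaw ν)
    hΨ.lintegral_prod_right').trans_le ?_
  have h1 : ∀ m, ∫⁻ z, powDensity d (z + h m) * ∫⁻ c, Ψ ((z, z + h m, m), c) ∂pointLaw ν ≤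
      w m * (powDensity d θ * ENNReal.ofReal δ *
        ∫⁻ c, K (bellman d θ h c) ∂pointLaw ν) := by
    intro m
    have h2 : ∀ z, powDensity d (z + h m) * ∫⁻ c, Ψ ((z, z + h m, m), c) ∂pointLaw ν =
        ∫⁻ c, powDensity d (z + h m) * Ψ ((z, z + h m, m), c) ∂pointLaw ν := fun z =>
      (lintegral_const_mul _ (hΨ.comp measurable_prodMk_left)).symm
    simp only [h2]
    rw [lintegral_lintegral_swap (Measurable.aemeasurable (by
      simp only [Function.uncurry_def]; fun_prop)),
      ← lintegral_const_mul _ (by fun_prop), ← lintegral_const_mul _ (by fun_prop)]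
    refine lintegral_mono fun c => ?_
    calc ∫⁻ z, powDensity d (z + h m) * Ψ ((z, z + h m, m), c)
        ≤ ∫⁻ z, (Ioc (bellman d θ h c) (bellman d θ h c + δ)).indicator
            (fun _ => powDensity d θ * (w m * K (bellman d θ h c))) z := by
          refine lintegral_mono fun z => ?_
          by_cases h3 : z + h m ≤ θ ∧ bellman d θ h c < z ∧ z ≤ bellman d θ h c + δ
          · rw [indicator_of_mem (show z ∈ Ioc _ _ from h3.2)]
            simp only [Ψ, if_pos h3]
            -- Given the mark and the other points, the offer ranges over a window of length `δ`,
            -- and the density of lengths up to `θ` is at most its value at `θ`.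
            exact mul_le_mul_left (powDensity_mono hd h3.1) _
          · simp only [Ψ, if_neg h3, mul_zero]; exact zero_le
      _ = w m * (powDensity d θ * ENNReal.ofReal δ * K (bellman d θ h c)) := by
          rw [lintegral_indicator measurableSet_Ioc, lintegral_const, Measure.restrict_apply_univ,
            Real.volume_Ioc, add_sub_cancel_left]
          ring
  calc _ ≤ ∫⁻ m, w m * (powDensity d θ * ENNReal.ofReal δ *
        ∫⁻ c, K (bellman d θ h c) ∂pointLaw ν) ∂ν := lintegral_mono h1
    _ = _ := by rw [lintegral_mul_const _ hw]; ring

/-- The weight `w` is dominated, conditionally on `h`, by `C` times the indicator of `h ∈ R`. -/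
def Dominated (ν : Measure M) (h : M → ℝ) (w : M → ENNReal) (C : ENNReal) (R : Set ℝ) : Prop :=
  ∀ K : ℝ → ENNReal, Measurable K → ∫⁻ m, w m * K (h m) ∂ν ≤ C * ∫⁻ m in h ⁻¹' R, K (h m) ∂ν

/-- Points with `h < θ / 2` have at most their share of the density. -/
lemma setLIntegral_powDensity_le (ν : Measure M) [IsProbabilityMeasure ν] (hd : 1 ≤ d)
    (hh : Measurable h) (hle : ∀ᵐ m ∂ν, h m ≤ θ / 2) (z : ℝ) :
    ∫⁻ m in h ⁻¹' Iio (θ / 2), powDensity d (z + h m) ∂ν ≤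
      ν (h ⁻¹' Iio (θ / 2)) * ∫⁻ m, powDensity d (z + h m) ∂ν := by
  set S := h ⁻¹' Iio (θ / 2) with hS
  have hSm : MeasurableSet S := hh measurableSet_Iio
  set κ := powDensity d (z + θ / 2) with hκ
  have h1 : ∫⁻ m in S, powDensity d (z + h m) ∂ν ≤ ν S * κ := by
    calc _ ≤ ∫⁻ _ in S, κ ∂ν := by
          refine setLIntegral_mono measurable_const fun m hm => powDensity_mono hd ?_
          have : h m < θ / 2 := hm
          linarith
      _ = _ := by rw [lintegral_const, Measure.restrict_apply_univ, mul_comm]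
  have h2 : ∫⁻ m in Sᶜ, powDensity d (z + h m) ∂ν = ν Sᶜ * κ := by
    calc _ = ∫⁻ _ in Sᶜ, κ ∂ν := by
          refine lintegral_congr_ae ?_
          filter_upwards [ae_restrict_mem hSm.compl, ae_restrict_of_ae hle] with m h3 h4
          have h5 : θ / 2 ≤ h m := not_lt.1 h3
          rw [le_antisymm h4 h5]
      _ = _ := by rw [lintegral_const, Measure.restrict_apply_univ, mul_comm]
  rw [← lintegral_add_compl (fun m => powDensity d (z + h m)) hSm (μ := ν), h2, mul_add]
  -- A Chebyshev-type inequality: the density is at most `κ` on `S` and almost everywhere equal to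
  -- `κ` off `S`. Splitting the factor `1` as `ν S + ν Sᶜ` makes the comparison without subtraction
  -- or division.
  calc ∫⁻ m in S, powDensity d (z + h m) ∂ν
      = (ν S + ν Sᶜ) * ∫⁻ m in S, powDensity d (z + h m) ∂ν := by
        rw [measure_add_measure_compl hSm, measure_univ, one_mul]
    _ ≤ ν S * ∫⁻ m in S, powDensity d (z + h m) ∂ν + ν Sᶜ * (ν S * κ) := by
        rw [add_mul]; gcongr
    _ = _ := by ring

end Steps

section Steps

variable {M : Type*} [MeasurableSpace M] {d θ : ℝ} {h : M → ℝ} {w : M → ENNReal} {K : ℝ → ENNReal}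

lemma Dominated.powDensity_le {ν : Measure M} {C α : ENNReal} {R : Set ℝ}
    (hw : Dominated ν h w C R)
    (hα : ∀ z, ∫⁻ m in h ⁻¹' R, powDensity d (z + h m) ∂ν ≤
      α * ∫⁻ m, powDensity d (z + h m) ∂ν) (z : ℝ) :
    ∫⁻ m, w m * powDensity d (z + h m) ∂ν ≤ C * α * ∫⁻ m, powDensity d (z + h m) ∂ν := by
  have hk := measurable_powDensity d
  rw [mul_assoc]
  exact (hw (fun y => powDensity d (z + y)) (by fun_prop)).trans (mul_le_mul_right (hα z) _)

/-- Given the optimal offer `z`, the mark has law proportional to `powDensity d (z + h m)`. Hence a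
bound on the biased mean of `w`, uniform in `z`, passes to the whole expectation; the case `w = 1`
supplies the normalization. -/
lemma lintegral_optimal_le (ν : Measure M) [IsProbabilityMeasure ν] (hd : 1 ≤ d)
    (hh : Measurable h) (hle : ∀ᵐ m ∂ν, h m ≤ θ / 2) (hw : Measurable w) (hK : Measurable K)
    {β : ENNReal} (hβ : ∀ z, ∫⁻ m, w m * powDensity d (z + h m) ∂ν ≤
      β * ∫⁻ m, powDensity d (z + h m) ∂ν) :
    ∫⁻ q, ∫⁻ c, (if q.1 ^ (1 / d) ≤ θ ∧ offer d h q ≤ bellman d θ h c then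
        w q.2 * K (offer d h q) else 0) ∂pointLaw ν ∂((volume.restrict (Ioi 0)).prod ν) ≤
      β * ∫⁻ c, (if bellman d θ h c < θ / 2 then K (bellman d θ h c) else 0) ∂pointLaw ν := by
  have hk := measurable_powDensity d
  have hp : Measurable fun z => pointLaw ν {c | z ≤ bellman d θ h c} := by
    have : Antitone fun z => pointLaw ν {c | z ≤ bellman d θ h c} :=
      fun a b hab => measure_mono fun c hc => hab.trans hc
    exact this.measurable
  have h1 := lintegral_optimal_eq (w := fun _ => 1) ν hd hh hle measurable_const hK
  simp only [one_mul] at h1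
  have h2 : Measurable fun z => ∫⁻ m, powDensity d (z + h m) ∂ν :=
    Measurable.lintegral_prod_right' (f := fun p : ℝ × M => powDensity d (p.1 + h p.2))
      (by fun_prop)
  have h3 : Measurable fun z => (∫⁻ m, powDensity d (z + h m) ∂ν) *
      (pointLaw ν {c | z ≤ bellman d θ h c} * K z) := h2.mul (hp.mul hK)
  rw [← lintegral_optimal ν hd hh hK, h1, lintegral_optimal_eq ν hd hh hle hw hK,
    ← lintegral_const_mul _ h3]
  refine lintegral_mono fun z => ?_
  have h4 := mul_le_mul_left (hβ z) (pointLaw ν {c | z ≤ bellman d θ h c} * K z)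
  rwa [mul_assoc β] at h4

/-- One optimal move: its outcome has a value less than `θ / 2`. -/
lemma lintegral_optimal_step (ν : Measure M) [IsProbabilityMeasure ν] (hd : 1 ≤ d)
    (hh : Measurable h) (hle : ∀ᵐ m ∂ν, h m ≤ θ / 2) (hw : Measurable w) (hK : Measurable K)
    {C : ENNReal} (hdom : Dominated ν h w C univ) :
    ∫⁻ c, (∑' i, (if (c i).1 ^ (1 / d) ≤ θ ∧ offer d h (c i) = bellman d θ h c then
        w (c i).2 else 0)) * K (bellman d θ h c) ∂pointLaw ν ≤
      C * ∫⁻ c, (if bellman d θ h c < θ / 2 then K (bellman d θ h c) else 0) ∂pointLaw ν := by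
  simp only [← ENNReal.tsum_mul_right, ite_mul, zero_mul]
  rw [lintegral_tsum_optimal ν hd hh hw hK]
  refine lintegral_optimal_le ν hd hh hle hw hK fun z => ?_
  have := hdom.powDensity_le (d := d) (α := 1) (fun z => by simp) z
  rwa [mul_one] at this

/-- One move that is optimal up to `δ`. -/
lemma lintegral_nearOptimal_step (ν : Measure M) [IsProbabilityMeasure ν] (hd : 1 ≤ d)
    (hh : Measurable h) (hle : ∀ᵐ m ∂ν, h m ≤ θ / 2) (hw : Measurable w) (hK : Measurable K)
    {C α : ENNReal} {R : Set ℝ} (hdom : Dominated ν h w C R)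
    (hα : ∀ z, ∫⁻ m in h ⁻¹' R, powDensity d (z + h m) ∂ν ≤
      α * ∫⁻ m, powDensity d (z + h m) ∂ν) {δ : ℝ} (hδ : 0 ≤ δ) :
    ∫⁻ c, (∑' i, (if (c i).1 ^ (1 / d) ≤ θ ∧ offer d h (c i) ≤ bellman d θ h c + δ then
        w (c i).2 else 0)) * K (bellman d θ h c) ∂pointLaw ν ≤
      C * (α + powDensity d θ * ENNReal.ofReal δ) *
        ∫⁻ c, K (bellman d θ h c) ∂pointLaw ν := by
  have hz := measurable_offer (d := d) hh
  have hb := measurable_bellman (d := d) (θ := θ) hh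
  -- The value of the root is the minimum of the offer of the chosen point and the value without it.
  -- `A` collects the optimal choices and `B` those that exceed the optimum by at most `δ`.
  let H : (ℝ × M) × (ℕ → ℝ × M) → ENNReal := fun x =>
    if x.1.1 ^ (1 / d) ≤ θ ∧ offer d h x.1 ≤ bellman d θ h x.2 + δ then
      w x.1.2 * K (min (offer d h x.1) (bellman d θ h x.2)) else 0
  let A : (ℝ × M) × (ℕ → ℝ × M) → ENNReal := fun x =>
    if x.1.1 ^ (1 / d) ≤ θ ∧ offer d h x.1 ≤ bellman d θ h x.2 then
      w x.1.2 * K (offer d h x.1) else 0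
  let B : (ℝ × M) × (ℕ → ℝ × M) → ENNReal := fun x =>
    if x.1.1 ^ (1 / d) ≤ θ ∧ bellman d θ h x.2 < offer d h x.1 ∧
      offer d h x.1 ≤ bellman d θ h x.2 + δ then w x.1.2 * K (bellman d θ h x.2) else 0
  have h0 : Measurable fun x : (ℝ × M) × (ℕ → ℝ × M) => x.1.1 ^ (1 / d) := by fun_prop
  have hz1 : Measurable fun x : (ℝ × M) × (ℕ → ℝ × M) => offer d h x.1 := hz.comp measurable_fst
  have hb1 : Measurable fun x : (ℝ × M) × (ℕ → ℝ × M) => bellman d θ h x.2 :=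
    hb.comp measurable_snd
  have hH : Measurable H := Measurable.ite
    ((h0 measurableSet_Iic).inter (measurableSet_le hz1 (hb1.add_const δ))) (by fun_prop)
      measurable_const
  have hA : Measurable A := Measurable.ite
    ((h0 measurableSet_Iic).inter (measurableSet_le hz1 hb1)) (by fun_prop) measurable_const
  have hHAB : ∀ x, H x = A x + B x := by
    intro x
    by_cases h1 : x.1.1 ^ (1 / d) ≤ θ
    · rcases le_or_gt (offer d h x.1) (bellman d θ h x.2) with h2 | h2
      · simp only [H, A, B, h1, h2, true_and, min_eq_left h2, if_true, not_lt.2 h2, false_and,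
          if_false, add_zero]
        rw [if_pos (by linarith)]
      · simp only [H, A, B, h1, h2, true_and, min_eq_right h2.le, not_le.2 h2, if_false, zero_add]
    · simp only [H, A, B, h1, false_and, if_false, add_zero]
  have h1 : ∀ᵐ c ∂pointLaw ν, (∑' i, (if (c i).1 ^ (1 / d) ≤ θ ∧
      offer d h (c i) ≤ bellman d θ h c + δ then w (c i).2 else 0)) * K (bellman d θ h c) =
        ∑' i, H (c i, omitAt i c) := by
    filter_upwards [ae_goodPoints ν] with c hc
    rw [← ENNReal.tsum_mul_right]
    refine tsum_congr fun i => ?_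
    by_cases hi : (c i).1 ^ (1 / d) ≤ θ
    · have h2 := bellman_eq_min_omitAt (h := h) hd hc hi
      change _ = min (offer d h (c i)) _ at h2
      -- Removing the point does not affect near-optimality: if its offer is itself the minimum,
      -- both conditions hold because `0 ≤ δ`.
      have h3 : offer d h (c i) ≤ bellman d θ h c + δ ↔
          offer d h (c i) ≤ bellman d θ h (omitAt i c) + δ := by
        rw [h2]
        rcases le_total (offer d h (c i)) (bellman d θ h (omitAt i c)) with h4 | h4
        · rw [min_eq_left h4]
          constructor <;> intro <;> linarith
        · rw [min_eq_right h4]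
      simp only [H, hi, h3, true_and, ite_mul, zero_mul]
      rw [h2]
    · simp only [H, hi, false_and, if_false, zero_mul]
  rw [lintegral_congr_ae h1, mecke ν hH]
  have h2 : ∀ q, ∫⁻ c, H (q, c) ∂pointLaw ν =
      ∫⁻ c, A (q, c) ∂pointLaw ν + ∫⁻ c, B (q, c) ∂pointLaw ν := fun q => by
    simp only [hHAB]
    exact lintegral_add_left (hA.comp measurable_prodMk_left) _
  simp only [h2]
  rw [lintegral_add_left hA.lintegral_prod_right', mul_add, add_mul]
  refine add_le_add ?_ ?_
  · refine (lintegral_optimal_le ν hd hh hle hw hK (hdom.powDensity_le hα)).trans ?_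
    gcongr with c
    split_ifs
    · exact le_rfl
    · exact zero_le
  · refine (lintegral_excess_le ν hd hh hw hK δ).trans ?_
    gcongr
    have h3 := hdom (fun _ => 1) measurable_const
    simp only [mul_one, lintegral_const, Measure.restrict_apply_univ, one_mul] at h3
    exact h3.trans ((mul_le_mul_right prob_le_one _).trans_eq (mul_one _))

end Steps

/-! ### Geometric decay of the number of paths -/

section Count

variable {d θ δ : ℝ}

/-- The condition on a move from the root to its `i`-th child: it is optimal up to `δ` if `b` is
true, and optimal if `b` is false. -/
def Allowed (d θ δ : ℝ) (b : Bool) (c : ℕ → ℝ × Tree) (i : ℕ) : Prop :=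
  (c i).1 ^ (1 / d) ≤ θ ∧
    if b then offer d (upperLim d θ) (c i) ≤ bellman d θ (upperLim d θ) c + δ
    else offer d (upperLim d θ) (c i) = bellman d θ (upperLim d θ) c

open scoped Classical in
/-- The number of allowed paths with `n` moves from the root, where `b` tells whether the first
move may be suboptimal. -/
noncomputable def pathCount (d θ δ : ℝ) : ℕ → Bool → Tree → ENNReal
  | 0, _, _ => 1
  | n + 1, b, T => ∑' i, if Allowed d θ δ b (rootPoints T) i then
      pathCount d θ δ n (!b) (rootPoints T i).2 else 0

lemma measurableSet_allowed (b : Bool) (i : ℕ) :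
    MeasurableSet {c : ℕ → ℝ × Tree | Allowed d θ δ b c i} := by
  have hU := measurable_upperLim d θ
  have h0 : Measurable fun c : ℕ → ℝ × Tree => (c i).1 ^ (1 / d) := by fun_prop
  have hz : Measurable fun c : ℕ → ℝ × Tree => offer d (upperLim d θ) (c i) :=
    (measurable_offer hU).comp (measurable_pi_apply i)
  have hb := measurable_bellman (d := d) (θ := θ) hU
  cases b with
  | true =>
    have h1 := (h0 (measurableSet_Iic (a := θ))).inter (measurableSet_le hz (hb.add_const δ))
    convert h1 using 1
    ext c
    simp [Allowed]
  | false =>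
    have h1 := (h0 (measurableSet_Iic (a := θ))).inter (measurableSet_eq_fun hz hb)
    convert h1 using 1
    ext c
    simp [Allowed]

lemma measurable_pathCount (n : ℕ) (b : Bool) : Measurable (pathCount d θ δ n b) := by
  induction n generalizing b with
  | zero => exact measurable_const
  | succ n ih =>
    refine Measurable.tsum fun i => Measurable.ite
      (measurable_rootPoints (measurableSet_allowed b i)) ?_ measurable_const
    exact (ih _).comp (measurable_snd.comp ((measurable_pi_apply i).comp measurable_rootPoints))

lemma ae_upperLim_eq_bellman (hd : 1 ≤ d) (hθ : 0 ≤ θ) :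
    ∀ᵐ T ∂treeLaw, upperLim d θ T = bellman d θ (upperLim d θ) (rootPoints T) := by
  filter_upwards [ae_regular hd hθ] with T hT using hT.upperLim_eq_bellman hd hθ

lemma lintegral_upperLim (hd : 1 ≤ d) (hθ : 0 ≤ θ) {K : ℝ → ENNReal} (hK : Measurable K) :
    ∫⁻ c, K (bellman d θ (upperLim d θ) c) ∂pointLaw treeLaw =
      ∫⁻ T, K (upperLim d θ T) ∂treeLaw := by
  rw [lintegral_bellman_rootPoints (measurable_upperLim d θ) hK]
  refine lintegral_congr_ae ?_
  filter_upwards [ae_upperLim_eq_bellman hd hθ] with T hT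
  rw [← hT]

open scoped Classical in
lemma lintegral_pathCount_succ (hd : 1 ≤ d) (hθ : 0 ≤ θ) (n : ℕ) (b : Bool) {K : ℝ → ENNReal}
    (hK : Measurable K) :
    ∫⁻ T, pathCount d θ δ (n + 1) b T * K (upperLim d θ T) ∂treeLaw =
      ∫⁻ c, (∑' i, if Allowed d θ δ b c i then pathCount d θ δ n (!b) (c i).2 else 0) *
        K (bellman d θ (upperLim d θ) c) ∂pointLaw treeLaw := by
  have hb := measurable_bellman (d := d) (θ := θ) (measurable_upperLim d θ)
  rw [← map_rootPoints_treeLaw, lintegral_map _ measurable_rootPoints]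
  · refine lintegral_congr_ae ?_
    filter_upwards [ae_upperLim_eq_bellman hd hθ] with T hT
    rw [← hT]; rfl
  · refine Measurable.mul (Measurable.tsum fun i => Measurable.ite (measurableSet_allowed b i) ?_
      measurable_const) (hK.comp hb)
    exact (measurable_pathCount n _).comp (measurable_snd.comp (measurable_pi_apply i))

/-- A vertex of value `θ / 2` almost surely has no optimal move, so play ends there. Recording this
restriction of the range is what makes the preceding move of Alice contract. -/
lemma dominated_pathCount_false (hd : 1 ≤ d) (hθ : 0 ≤ θ) (n : ℕ) {C : ENNReal}
    (hdom : Dominated treeLaw (upperLim d θ) (pathCount d θ δ n true) C univ) :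
    Dominated treeLaw (upperLim d θ) (pathCount d θ δ (n + 1) false) C (Iio (θ / 2)) := by
  classical
  intro K hK
  rw [lintegral_pathCount_succ hd hθ n false hK]
  have h1 := lintegral_optimal_step treeLaw hd (measurable_upperLim d θ) (ae_upperLim_le hd hθ)
    (measurable_pathCount n true) hK hdom
  have hK' : Measurable fun y : ℝ => if y < θ / 2 then K y else 0 :=
    Measurable.ite measurableSet_Iio hK measurable_const
  rw [lintegral_upperLim hd hθ hK'] at h1
  have h2 : ∫⁻ T, (if upperLim d θ T < θ / 2 then K (upperLim d θ T) else 0) ∂treeLaw =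
      ∫⁻ T in upperLim d θ ⁻¹' Iio (θ / 2), K (upperLim d θ T) ∂treeLaw := by
    rw [← lintegral_indicator (measurable_upperLim d θ measurableSet_Iio)]
    rfl
  rw [h2] at h1
  simpa [Allowed] using h1

lemma dominated_pathCount_true (hd : 1 ≤ d) (hθ : 0 ≤ θ) (hδ : 0 ≤ δ) (n : ℕ) {C α : ENNReal}
    {R : Set ℝ} (hdom : Dominated treeLaw (upperLim d θ) (pathCount d θ δ n false) C R)
    (hα : ∀ z, ∫⁻ T in upperLim d θ ⁻¹' R, powDensity d (z + upperLim d θ T) ∂treeLaw ≤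
      α * ∫⁻ T, powDensity d (z + upperLim d θ T) ∂treeLaw) :
    Dominated treeLaw (upperLim d θ) (pathCount d θ δ (n + 1) true)
      (C * (α + powDensity d θ * ENNReal.ofReal δ)) univ := by
  classical
  intro K hK
  rw [lintegral_pathCount_succ hd hθ n true hK]
  have h1 := lintegral_nearOptimal_step treeLaw hd (measurable_upperLim d θ)
    (ae_upperLim_le hd hθ) (measurable_pathCount n false) hK hdom hα hδ
  rw [lintegral_upperLim hd hθ hK] at h1
  simpa [Allowed] using h1

lemma dominated_pathCount_zero (b : Bool) :
    Dominated treeLaw (upperLim d θ) (pathCount d θ δ 0 b) 1 univ := by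
  intro K _
  simp [pathCount]

/-- The expected number of allowed paths decays geometrically in the number of moves. -/
lemma dominated_pathCount (hd : 1 ≤ d) (hθ : 0 ≤ θ) (hδ : 0 ≤ δ) (n : ℕ) :
    Dominated treeLaw (upperLim d θ) (pathCount d θ δ (2 * n) true)
      ((treeLaw (upperLim d θ ⁻¹' Iio (θ / 2)) + powDensity d θ * ENNReal.ofReal δ) ^ n) univ ∧
    Dominated treeLaw (upperLim d θ) (pathCount d θ δ (2 * n + 1) true)
      ((1 + powDensity d θ * ENNReal.ofReal δ) *
        (treeLaw (upperLim d θ ⁻¹' Iio (θ / 2)) + powDensity d θ * ENNReal.ofReal δ) ^ n)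
        univ := by
  -- Two moves are prepended at once: one of Bob, restricting the range to values below `θ / 2`, and
  -- before it one of Alice, paying the factor.
  have hstep : ∀ m C, Dominated treeLaw (upperLim d θ) (pathCount d θ δ m true) C univ →
      Dominated treeLaw (upperLim d θ) (pathCount d θ δ (m + 2) true)
        (C * (treeLaw (upperLim d θ ⁻¹' Iio (θ / 2)) + powDensity d θ * ENNReal.ofReal δ))
          univ := fun m C hm =>
    dominated_pathCount_true hd hθ hδ (m + 1) (dominated_pathCount_false hd hθ m hm)
      (setLIntegral_powDensity_le treeLaw hd (measurable_upperLim d θ) (ae_upperLim_le hd hθ))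
  induction n with
  | zero =>
    refine ⟨by simpa using dominated_pathCount_zero true, ?_⟩
    have h1 := dominated_pathCount_true (α := 1) hd hθ hδ 0
      (dominated_pathCount_zero (d := d) (θ := θ) (δ := δ) false) fun z => by simp
    simpa using h1
  | succ n ih =>
    refine ⟨?_, ?_⟩
    · rw [pow_succ]; exact hstep _ _ ih.1
    · rw [pow_succ, ← mul_assoc]; exact hstep _ _ ih.2

lemma Dominated.lintegral_le {ν : Measure Tree} [IsProbabilityMeasure ν] {h : Tree → ℝ}
    {w : Tree → ENNReal} {C : ENNReal} (hw : Dominated ν h w C univ) : ∫⁻ T, w T ∂ν ≤ C := by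
  simpa using hw (fun _ => 1) measurable_const

lemma tsum_lintegral_pathCount_lt_top (hd : 1 ≤ d) (hθ : 0 ≤ θ) (hδ : 0 ≤ δ)
    (hq : treeLaw (upperLim d θ ⁻¹' Iio (θ / 2)) + powDensity d θ * ENNReal.ofReal δ < 1) :
    ∑' n, ∫⁻ T, pathCount d θ δ n true T ∂treeLaw < ⊤ := by
  set q := treeLaw (upperLim d θ ⁻¹' Iio (θ / 2)) + powDensity d θ * ENNReal.ofReal δ
  have hgeom : ∑' n : ℕ, q ^ n < ⊤ := by
    rw [ENNReal.tsum_geometric]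
    exact ENNReal.inv_lt_top.2 (tsub_pos_of_lt hq)
  rw [← tsum_even_add_odd ENNReal.summable ENNReal.summable]
  refine ENNReal.add_lt_top.2 ⟨?_, ?_⟩
  · exact (ENNReal.tsum_le_tsum fun n => (dominated_pathCount hd hθ hδ n).1.lintegral_le).trans_lt
      hgeom
  · refine (ENNReal.tsum_le_tsum fun n =>
      (dominated_pathCount hd hθ hδ n).2.lintegral_le).trans_lt ?_
    rw [ENNReal.tsum_mul_left]
    refine ENNReal.mul_lt_top ?_ hgeom
    exact ENNReal.add_lt_top.2 ⟨ENNReal.one_lt_top, ENNReal.mul_lt_top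
      (powDensity_ne_top d θ).lt_top ENNReal.ofReal_lt_top⟩

/-- The value `θ / 2` has positive probability. -/
lemma treeLaw_lt_half_lt_one (hd : 1 ≤ d) (hθ : 0 ≤ θ) :
    treeLaw (upperLim d θ ⁻¹' Iio (θ / 2)) < 1 := by
  have hU := measurable_upperLim d θ
  -- The tail is a fixed point of `V_θ`, hence an exponential and positive even at `θ / 2`.
  have h1 : tail treeLaw (upperLim d θ) (θ / 2) ≠ 0 :=
    ((isFixedPointV_tail hd hθ).pos (right_mem_Icc.2 (by linarith))).ne'
  refine lt_of_le_of_ne prob_le_one fun h2 => h1 ?_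
  rw [← prob_compl_eq_zero_iff (hU measurableSet_Iio)] at h2
  have h3 : (upperLim d θ ⁻¹' Iio (θ / 2))ᶜ = {T | θ / 2 ≤ upperLim d θ T} := by
    ext T; simp
  rw [h3] at h2
  simp [tail, h2]

lemma exists_delta (hd : 1 ≤ d) (hθ : 0 ≤ θ) : ∃ δ₀ : ℝ, 0 < δ₀ ∧ ∀ δ, 0 < δ → δ ≤ δ₀ →
    treeLaw (upperLim d θ ⁻¹' Iio (θ / 2)) + powDensity d θ * ENNReal.ofReal δ < 1 := by
  have h1 := treeLaw_lt_half_lt_one hd hθ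
  have h2 : Tendsto (fun δ : ℝ => treeLaw (upperLim d θ ⁻¹' Iio (θ / 2)) +
      powDensity d θ * ENNReal.ofReal δ) (𝓝 0)
      (𝓝 (treeLaw (upperLim d θ ⁻¹' Iio (θ / 2)) + powDensity d θ * ENNReal.ofReal 0)) :=
    tendsto_const_nhds.add (ENNReal.Tendsto.const_mul
      (ENNReal.tendsto_ofReal tendsto_id) (Or.inr (powDensity_ne_top d θ)))
  rw [ENNReal.ofReal_zero, mul_zero, add_zero] at h2
  obtain ⟨ε, hε, h3⟩ := Metric.eventually_nhds_iff.1 (h2.eventually_lt_const h1)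
  refine ⟨ε / 2, by linarith, fun δ hδ hle => h3 ?_⟩
  rw [Real.dist_eq, sub_zero, abs_of_pos hδ]
  linarith

end Count

/-! ### From path counts to the set of vertices -/

section Near

variable {d θ δ : ℝ} {T : Tree}

/-- The vertices reached from the root by allowed moves, where `b` tells whether the moves from
vertices at even distance from the root may be suboptimal. -/
def AllowedPath (d θ δ : ℝ) (T : Tree) (b : Bool) : List ℕ → Prop
  | [] => True
  | i :: v => AllowedPath d θ δ T b v ∧
      Allowed d θ δ (if Even v.length then b else !b) (rootPoints (subtreeAt v T)) i

/-- On a regular tree `f_B` is `upperLim` and satisfies the recursion at every vertex, so conditions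
on `f_B` become conditions on the value computed from the children. -/
lemma Regular.nearOptimal_iff (hT : Regular d θ T) (hd : 1 ≤ d) (hθ : 0 ≤ θ) (v : List ℕ) :
    nearOptimal (len d T) θ δ v ↔ AllowedPath d θ δ T true v := by
  induction v with
  | nil => rfl
  | cons i v ih =>
    simp only [nearOptimal, AllowedPath, ih, Allowed, offer, hT.valueB_eq hd hθ,
      ← (hT.subtreeAt v).upperLim_eq_bellman hd hθ, rootPoints_subtreeAt_fst,
      rootPoints_subtreeAt_snd]
    by_cases h : Even v.length <;> simp [h]

lemma subtreeAt_append_singleton (v : List ℕ) (i : ℕ) (T : Tree) :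
    subtreeAt (v ++ [i]) T = subtreeAt v (rootPoints T i).2 := by
  funext p
  simp [subtreeAt, rootPoints, points, branches, subtree]

/-- `AllowedPath` peels off the last move and `pathCount` the first. Entering the subtree of a child
shifts the parity of all distances, hence `!b`. -/
lemma allowedPath_append_singleton (T : Tree) (b : Bool) (v : List ℕ) (i : ℕ) :
    AllowedPath d θ δ T b (v ++ [i]) ↔
      Allowed d θ δ b (rootPoints T) i ∧ AllowedPath d θ δ (rootPoints T i).2 (!b) v := by
  induction v with
  | nil => simp [AllowedPath, subtreeAt_nil]
  | cons j v ih =>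
    simp only [List.cons_append, AllowedPath, ih, subtreeAt_append_singleton, List.length_append,
      List.length_singleton, Nat.even_add_one, and_assoc]
    by_cases h : Even v.length <;> simp [h]

open scoped Classical in
lemma tsum_allowedPath (n : ℕ) (b : Bool) (T : Tree) :
    ∑' v : List ℕ, (if v.length = n ∧ AllowedPath d θ δ T b v then (1 : ENNReal) else 0) =
      pathCount d θ δ n b T := by
  induction n generalizing b T with
  | zero =>
    rw [tsum_eq_single []]
    · simp [AllowedPath, pathCount]
    · intro v hv
      simp [hv]
  | succ n ih =>
    -- Nonempty paths are parametrized by their first move, the last entry of the list, and the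
    -- remaining path.
    have hinj : Function.Injective fun p : ℕ × List ℕ => p.2 ++ [p.1] := by
      rintro ⟨i, v⟩ ⟨j, w⟩ h
      obtain ⟨h1, h2⟩ := List.append_inj' h rfl
      simp_all
    rw [← hinj.tsum_eq, ENNReal.tsum_prod (f := fun i v => if (v ++ [i]).length = n + 1 ∧
      AllowedPath d θ δ T b (v ++ [i]) then (1 : ENNReal) else 0)]
    · refine tsum_congr fun i => ?_
      split_ifs with hi
      · rw [← ih]
        simp [allowedPath_append_singleton, hi]
      · simp [allowedPath_append_singleton, hi]
    · intro v hv
      rcases List.eq_nil_or_concat v with rfl | ⟨w, i, rfl⟩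
      · simp at hv
      · exact ⟨(i, w), by simp⟩

lemma encard_allowedPath (b : Bool) (T : Tree) :
    (({v | AllowedPath d θ δ T b v}.encard : ℕ∞) : ENNReal) = ∑' n, pathCount d θ δ n b T := by
  classical
  simp only [← tsum_allowedPath]
  rw [ENNReal.tsum_comm, ← ENNReal.tsum_set_one, tsum_subtype _ (fun _ => (1 : ENNReal))]
  refine tsum_congr fun v => ?_
  rw [tsum_eq_single v.length]
  · simp [indicator]
  · intro n hn
    simp [hn.symm]

lemma IsPWIT.lintegral_encard_nearOptimal {Ω : Type u} [MeasurableSpace Ω] {P : Measure Ω}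
    [IsProbabilityMeasure P] {ℓ : Ω → List ℕ → ℕ → ℝ} (h : IsPWIT d P ℓ) (hd : 1 ≤ d)
    (hθ : 0 ≤ θ) :
    ∫⁻ ω, (({v : List ℕ | nearOptimal (ℓ ω) θ δ v}.encard : ℕ∞) : ENNReal) ∂P =
      ∑' n, ∫⁻ T, pathCount d θ δ n true T ∂treeLaw := by
  obtain ⟨X, hX, hℓ⟩ := h.exists_measurePreserving
  have h1 : ∀ n, Measurable (pathCount d θ δ n true) := fun n => measurable_pathCount n true
  rw [← lintegral_tsum fun n => (h1 n).aemeasurable,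
    ← hX.lintegral_comp (Measurable.tsum h1)]
  refine lintegral_congr_ae ?_
  filter_upwards [hX.quasiMeasurePreserving.ae (ae_regular hd hθ)] with ω hω
  simp only [hℓ, hω.nearOptimal_iff hd hθ, encard_allowedPath]

end Near

end GraphExploration

theorem mainTheorem3 (d θ : ℝ) (hd : 1 ≤ d) (hθ : 0 ≤ θ) :
    (∀ (Ω : Type u) [MeasurableSpace Ω] (P : Measure Ω) [IsProbabilityMeasure P]
        (ℓ : Ω → List ℕ → ℕ → ℝ), GraphExploration.IsPWIT d P ℓ →
        ∀ᵐ ω ∂P,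
          (∃! f : {v : List ℕ // GraphExploration.cluster (ℓ ω) θ v} → ℝ,
            GraphExploration.IsValuation (ℓ ω) θ f) ∧
          (∀ v : {v : List ℕ // GraphExploration.cluster (ℓ ω) θ v},
            Tendsto (fun k : ℕ => GraphExploration.partialA (ℓ ω) θ k v.1) atTop
              (𝓝 (GraphExploration.valueA (ℓ ω) θ v.1)) ∧
            Tendsto (fun k : ℕ => GraphExploration.partialB (ℓ ω) θ k v.1) atTop
              (𝓝 (GraphExploration.valueB (ℓ ω) θ v.1))) ∧
          GraphExploration.IsValuation (ℓ ω) θ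
            (fun v => GraphExploration.valueA (ℓ ω) θ v.1) ∧
          GraphExploration.IsValuation (ℓ ω) θ
            (fun v => GraphExploration.valueB (ℓ ω) θ v.1) ∧
          (∀ v : {v : List ℕ // GraphExploration.cluster (ℓ ω) θ v},
            GraphExploration.valueA (ℓ ω) θ v.1 = GraphExploration.valueB (ℓ ω) θ v.1)) ∧
    (∃ F : ℝ → ℝ, GraphExploration.IsFixedPointV d θ F ∧
      ∀ G : ℝ → ℝ, GraphExploration.IsFixedPointV d θ G →
        EqOn G F (Icc (-(θ / 2)) (θ / 2))) ∧
    (∃ δ₀ : ℝ, 0 < δ₀ ∧ ∀ δ : ℝ, 0 < δ → δ ≤ δ₀ →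
      ∀ (Ω : Type u) [MeasurableSpace Ω] (P : Measure Ω) [IsProbabilityMeasure P]
        (ℓ : Ω → List ℕ → ℕ → ℝ), GraphExploration.IsPWIT d P ℓ →
        ∫⁻ ω, (({v : List ℕ | GraphExploration.nearOptimal (ℓ ω) θ δ v}.encard : ℕ∞) : ENNReal) ∂P
          < ⊤) := by
  refine ⟨?_, ⟨_, GraphExploration.isFixedPointV_tail hd hθ, fun G hG => hG.eqOn_tail hd hθ⟩, ?_⟩
  · intro Ω _ P _ ℓ h
    obtain ⟨X, hX, hℓ⟩ := h.exists_measurePreserving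
    filter_upwards [hX.quasiMeasurePreserving.ae (GraphExploration.ae_regular hd hθ)] with ω hω
    rw [hℓ]
    simp only [hω.valueA_eq hd hθ, hω.valueB_eq hd hθ, implies_true, and_true]
    exact ⟨hω.existsUnique_valuation hd hθ,
      fun v => ⟨hω.tendsto_partialA hd hθ v.1, hω.tendsto_partialB hd hθ v.1⟩,
      hω.isValuation hd hθ, hω.isValuation hd hθ⟩
  · obtain ⟨δ₀, hpos, hlt⟩ := GraphExploration.exists_delta hd hθ
    refine ⟨δ₀, hpos, fun δ hδ hle Ω _ P _ ℓ h => ?_⟩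
    rw [h.lintegral_encard_nearOptimal hd hθ]
    exact GraphExploration.tsum_lintegral_pathCount_lt_top hd hθ hδ.le (hlt δ hδ hle)
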